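/- **Conventions.** Fix a universe $\mathfrak U$. Let $\mathcal C$ be an essentially $\mathfrak U$-small category with a Grothendieck topology $J$, and let $\mathcal T=\mathcal T(J)$ be the set of morphisms $f:Y\to X$ of $\mathcal C$ such that the sieve generated by $f$ belongs to $J(X)$. A set $T$ of morphisms is *semi-localizing* if it contains the identities, is closed under composition, and every diagram $Y_1\xrightarrow{f_1}X\xleftarrow{f_2}Y_2$ with $f_1\in T$ can be completed to a commutative square $f_1g_1=f_2g_2$ with $g_2:Z\to Y_2$ in $T$. A morphism $f:X\to Y$ of a category is a *Galois covering* if for every object $Z$ the group $\mathrm{Aut}_Y(X)$ acts simply transitively on each non-empty fibre of $\mathrm{Hom}(Z,X)\to\mathrm{Hom}(Z,Y)$. The pair $(\mathcal C,J)$ is a *$Y$-site* if: (a) there is a semi-localizing $T$ such that a sieve is $J$-covering if and only if it contains an element of $T$; (b) every morphism of $\mathcal C$ is an epimorphism; (c) $f\circ g\in\mathcal T$ if and only if $f,g\in\mathcal T$; (d) for every $f:X\to Y$ in $\mathcal T$ there is $g:Z\to X$ in $\mathcal T$ with $f\circ g$ a Galois covering; (e) for any two objects $X,Y$ there are morphisms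 $X\leftarrow Z\to Y$ in $\mathcal T$. Let $(\mathcal C,J)$ be a $Y$-site such that for all $f:X\to Z$ and $g:Y\to Z$ in $\mathcal T$ there are only finitely many morphisms $X\to Y$ over $Z$. **The enlarged category.** For an object $X$ of $\mathcal C$ and a subgroup $H\subset\mathrm{Aut}(X)$, let $X/H$ be the sheaf associated with the presheaf $H\backslash\mathrm{Hom}(-,X)$. The subgroup $H$ is *moderate* if $H\subset\mathrm{Aut}_Y(X)$ for some $X\to Y$ in $\mathcal T$. Let $\widetilde{\mathcal C}$ be a full subcategory of the category of sheaves of sets $\mathrm{Shv}(\mathcal C,J)$, closed under isomorphism, all of whose objects are isomorphic to some $X/H$ with $H$ moderate, and which contains $X/\{\mathrm{id}_X\}$ for all $X$. Let $\widetilde{\mathcal T}$ be the set of morphisms $f:F_1\to F_2$ of $\widetilde{\mathcal C}$ for which there are isomorphisms $F_i\cong X_i/H_i$ ($H_i$ moderate, $i=1,2$) and morphisms $X_1\xleftarrow{m}X'\xrightarrow{f'}X_2$ in $\mathcal T$ such that the composites $X'/\{\mathrm{id}\}\xrightarrow{m}X_1/\{\mathrm{id}\}\to X_1/H_1\cong F_1\xrightarrow{f}F_2$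 and $X'/\{\mathrm{id}\}\xrightarrow{f'}X_2/\{\mathrm{id}\}\to X_2/H_2\cong F_2$ coincide. Let $\widetilde{\mathcal{FC}}\subset\mathrm{Shv}(\mathcal C,J)$ be the full subcategory of finite coproducts (in $\mathrm{Shv}(\mathcal C,J)$) of objects of $\widetilde{\mathcal C}$. Each object $F$ is a finite coproduct $F=\coprod_{i\in\pi_0(F)}F_i$ of its connected components $F_i\in\widetilde{\mathcal C}$, and a morphism $f:F\to F'$ amounts to a map $\pi_0(f):\pi_0(F)\to\pi_0(F')$ together with components $f_i:F_i\to F'_{\pi_0(f)(i)}$. Let $\widetilde{\mathcal{FT}}$ be the set of morphisms all of whose components lie in $\widetilde{\mathcal T}$. Let $\iota':\mathcal C\to\widetilde{\mathcal{FC}}$ be $X\mapsto X/\{\mathrm{id}_X\}$ and equip $\widetilde{\mathcal{FC}}$ with the topology $\iota'_*J$ in which a sieve $R$ on $F$ is covering if and only if for every $f:\iota'(Y)\to F$ the morphisms $g:Z\to Y$ of $\mathcal C$ with $f\circ\iota'(g)\in R$ form a sieve in $J(Y)$. **Degree.** For $f:X\to Y$ in $\widetilde{\mathcal T}$ choose $g:Z\to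 X$ in $\widetilde{\mathcal T}$ with $f\circ g$ a Galois covering in $\widetilde{\mathcal C}$; then $\deg f$ is the number of morphisms from $Z$ to $X$ over $Y$ (this does not depend on $g$). For $f:F\to F'$ in $\widetilde{\mathcal{FT}}$ and $j\in\pi_0(F')$ put $\deg(f)(j)=\sum_{i\in\pi_0(F),\ \pi_0(f)(i)=j}\deg f_i$. **Transfers.** A structure of *abelian presheaf with transfers* on a presheaf $G$ of abelian groups on $\widetilde{\mathcal{FC}}$, where $G$ is required to send initial objects to $0$ and finite coproducts to products, is a family of homomorphisms $f_*:G(F)\to G(F')$, one for each $f:F\to F'$ in $\widetilde{\mathcal{FT}}$, such that (1) $(f\circ f')_*=f_*\circ f'_*$ for composable $f,f'\in\widetilde{\mathcal{FT}}$ (and $f\circ f'\in\widetilde{\mathcal{FT}}$); (2) for every cartesian square in $\widetilde{\mathcal{FC}}$ with sides $g_1:F_1\to F_1'$, $f:F_1\to F_2$, $f':F_1'\to F_2'$, $g_2:F_2\to F_2'$ ($f'g_1=g_2f$) and $f'\in\widetilde{\mathcal{FT}}$, one has $f\in\widetilde{\mathcal{FT}}$ and $g_2^*\circ f'_*=f_*\circ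 g_1^*$; (3) for every $f:F\to F'$ in $\widetilde{\mathcal{FT}}$, the endomorphism $f_*\circ f^*$ of $G(F')=\prod_{j\in\pi_0(F')}G(F'_j)$ is $(x_j)_j\mapsto(\deg(f)(j)\,x_j)_j$. A structure of *presheaf of rings with transfers* on a presheaf $G$ of rings is a structure of abelian presheaf with transfers on its additive presheaf such that $f_*(x\cdot f^*y)=f_*(x)\cdot y$ and $f_*(f^*y\cdot x)=y\cdot f_*(x)$ for all $f:F\to F'$ in $\widetilde{\mathcal{FT}}$, $x\in G(F)$, $y\in G(F')$. **Proposition.** Every sheaf of abelian groups on $(\widetilde{\mathcal{FC}},\iota'_*J)$ has one and only one structure of abelian presheaf with transfers. Every sheaf of (unital, not necessarily commutative) rings on $(\widetilde{\mathcal{FC}},\iota'_*J)$ has one and only one structure of presheaf of rings with transfers. -/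

import Mathlib

open CategoryTheory CategoryTheory.Limits Opposite

universe w v u

namespace YSite

section Generalities

variable {C : Type u} [Category.{v} C]

/-- `f : X ⟶ Y` is a Galois covering: for every `Z`, the group of automorphisms of `X` over `Y`
acts simply transitively on every non-empty fibre of `Hom(Z, X) → Hom(Z, Y)`. -/
def IsGaloisCovering {X Y : C} (f : X ⟶ Y) : Prop :=
  ∀ ⦃Z : C⦄ (h₁ h₂ : Z ⟶ X), h₁ ≫ f = h₂ ≫ f →
    ∃! g : Aut X, g.hom ≫ f = f ∧ h₁ ≫ g.hom = h₂

/-- The morphisms from `f : Z ⟶ Y` to `g : X ⟶ Y` in the overcategory of `Y`. -/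
abbrev HomOver {X Y Z : C} (f : Z ⟶ Y) (g : X ⟶ Y) : Type v := {h : Z ⟶ X // h ≫ g = f}

/-- Semi-localizing collections of morphisms. -/
structure IsSemiLocalizing (T : MorphismProperty C) : Prop where
  id_mem : ∀ X : C, T (𝟙 X)
  comp_mem : ∀ ⦃X Y Z : C⦄ (f : X ⟶ Y) (g : Y ⟶ Z), T f → T g → T (f ≫ g)
  square : ∀ ⦃X Y₁ Y₂ : C⦄ (f₁ : Y₁ ⟶ X) (f₂ : Y₂ ⟶ X), T f₁ →
    ∃ (Z : C) (g₁ : Z ⟶ Y₁) (g₂ : Z ⟶ Y₂), T g₂ ∧ g₁ ≫ f₁ = g₂ ≫ f₂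

/-- `J` is an `A`-topology: for some semi-localizing collection `T`, the covering sieves of `J`
are exactly the sieves that contain a member of `T`. -/
def IsATopology (J : GrothendieckTopology C) : Prop :=
  ∃ T : MorphismProperty C, IsSemiLocalizing T ∧
    ∀ (X : C) (R : Sieve X), R ∈ J X ↔ ∃ (Y : C) (f : Y ⟶ X), T f ∧ R f

/-- The collection `𝒯(J)` of the morphisms which generate a covering sieve. -/
def typeJ (J : GrothendieckTopology C) : MorphismProperty C :=
  fun _ X f => Sieve.generate (Presieve.singleton f) ∈ J X

/-- `B`-sites. -/
structure IsBSite (J : GrothendieckTopology C) : Prop where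
  isATopology : IsATopology J
  epi : ∀ ⦃X Y : C⦄ (f : X ⟶ Y), Epi f
  comp_mem_iff : ∀ ⦃X Y Z : C⦄ (g : Z ⟶ Y) (f : Y ⟶ X),
    typeJ J (g ≫ f) ↔ typeJ J g ∧ typeJ J f

/-- `Y`-sites. The underlying category is moreover supposed to be essentially small: where
`Y`-sites are used, this is the type class `EssentiallySmall.{v} C`. -/
structure IsYSite (J : GrothendieckTopology C) : Prop where
  isBSite : IsBSite J
  /-- `𝒯(J)` has enough Galois coverings -/
  enough_galois : ∀ ⦃X Y : C⦄ (f : X ⟶ Y), typeJ J f →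
    ∃ (Z : C) (g : Z ⟶ X), typeJ J g ∧ IsGaloisCovering (g ≫ f)
  /-- the category of objects of `C` and morphisms in `𝒯(J)` is `Λ`-connected -/
  connected : ∀ X Y : C, ∃ (Z : C) (f : Z ⟶ X) (g : Z ⟶ Y), typeJ J f ∧ typeJ J g

/-- For every `Z`, the overcategory of `Z` in the category of objects of `C` and morphisms in
`𝒯(J)` has finite sets of morphisms. -/
def HasFiniteOverHoms (J : GrothendieckTopology C) : Prop :=
  ∀ ⦃X Y Z : C⦄ (f : X ⟶ Z) (g : Y ⟶ Z), typeJ J f → typeJ J g → Finite (HomOver f g)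

/-- The pushforward of `J` along `F`: the finest topology for which `F` is cocontinuous. A sieve
`S` on `X` is covering when for every `f : F(Y) ⟶ X` the morphisms `g : Z ⟶ Y` such that
`f ∘ F(g)` lies in `S` form a `J`-covering sieve of `Y`. -/
def pushforwardTopology {D : Type*} [Category* D] (F : C ⥤ D) (J : GrothendieckTopology C) :
    GrothendieckTopology D where
  sieves X := {S | ∀ (Y : C) (f : F.obj Y ⟶ X), (S.pullback f).functorPullback F ∈ J Y}
  top_mem' X Y f := by
    simp only [Sieve.pullback_top, Sieve.functorPullback_top, J.top_mem]
  pullback_stable' X X' S g hS Y f := by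
    rw [← Sieve.pullback_comp]
    exact hS Y (f ≫ g)
  transitive' X S hS R hR Y f := by
    refine J.transitive (hS Y f) _ fun Z g hg => ?_
    have h := hR hg Z (𝟙 _)
    refine J.superset_covering ?_ h
    intro W k hk
    simpa [Sieve.functorPullback, Presieve.functorPullback] using hk

end Generalities

section Quotients

variable {C : Type u} [Category.{v} C]

/-- Sheaves of sets on an essentially small site can be sheafified. -/
instance hasSheafifyOfEssentiallySmall [EssentiallySmall.{v} C] (J : GrothendieckTopology C) :
    HasSheafify J (Type v) :=
  hasSheafifyEssentiallySmallSite.{v} J (Type v)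

/-- The orbit relation of `H ⊆ Aut X` on `Hom(U, X)`. -/
def orbitSetoid {X : C} (H : Subgroup (Aut X)) (U : C) : Setoid (U ⟶ X) where
  r a b := ∃ h ∈ H, a ≫ h.hom = b
  iseqv :=
    { refl := fun a => ⟨1, H.one_mem, Category.comp_id a⟩
      symm := by
        rintro a b ⟨h, hh, rfl⟩
        exact ⟨h⁻¹, H.inv_mem hh,
          (Category.assoc _ _ _).trans (by rw [show h.hom ≫ (h⁻¹).hom = 𝟙 X from h.hom_inv_id,
            Category.comp_id])⟩
      trans := by
        rintro a b c ⟨h, hh, rfl⟩ ⟨k, hk, rfl⟩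
        exact ⟨k * h, H.mul_mem hk hh, (Category.assoc _ _ _).symm⟩ }

/-- The presheaf `U ↦ H \ Hom(U, X)`. -/
def quotientPresheaf {X : C} (H : Subgroup (Aut X)) : Cᵒᵖ ⥤ Type v where
  obj U := Quotient (orbitSetoid H U.unop)
  map {U V} g := TypeCat.ofHom (Quotient.map (fun a => g.unop ≫ a) (by
    rintro a b ⟨h, hh, rfl⟩
    exact ⟨h, hh, by simp⟩))
  map_id U := by
    ext x
    induction x using Quotient.inductionOn
    simp
  map_comp f g := by
    ext x
    induction x using Quotient.inductionOn
    simp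

/-- The projection from the presheaf represented by `X` to `quotientPresheaf H`. -/
def quotientPresheafProj {X : C} (H : Subgroup (Aut X)) : yoneda.obj X ⟶ quotientPresheaf H where
  app U := TypeCat.ofHom (fun a => Quotient.mk (orbitSetoid H U.unop) a)
  naturality U V g := by
    ext x
    rfl

variable [EssentiallySmall.{v} C] (J : GrothendieckTopology C)

/-- The sheaf associated with the presheaf represented by an object, as a functor. -/
noncomputable def reprSheaf : C ⥤ Sheaf J (Type v) :=
  yoneda ⋙ presheafToSheaf J (Type v)

variable {X : C}

/-- The quotient sheaf `X / H`. -/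
noncomputable def quotientSheaf (H : Subgroup (Aut X)) : Sheaf J (Type v) :=
  (presheafToSheaf J (Type v)).obj (quotientPresheaf H)

/-- The canonical quotient morphism `q_{X,H}`. -/
noncomputable def quotientProj (H : Subgroup (Aut X)) :
    (reprSheaf J).obj X ⟶ quotientSheaf J H :=
  (presheafToSheaf J (Type v)).map (quotientPresheafProj H)

/-- `H ⊆ Aut X` is moderate: it is contained in `Aut_Y(X)` for some `X ⟶ Y` in `𝒯(J)`. -/
def IsModerate (H : Subgroup (Aut X)) : Prop :=
  ∃ (Y : C) (f : X ⟶ Y), typeJ J f ∧ ∀ h ∈ H, h.hom ≫ f = f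

/-- The sheaves isomorphic to `X / H` with `X` in `C` and `H ⊆ Aut X` moderate. -/
def moderateQuotients : ObjectProperty (Sheaf J (Type v)) :=
  fun F => ∃ (X : C) (H : Subgroup (Aut X)), IsModerate J H ∧ Nonempty (quotientSheaf J H ≅ F)

/-- The collection `𝒯̃`, for morphisms between moderate quotients: `f : F₁ ⟶ F₂` belongs to it when,
for some identifications of `F₁`, `F₂` with moderate quotients `X₁ / H₁`, `X₂ / H₂`, it has
a representative `X₁ ⟵ X' ⟶ X₂` in `C` whose two legs are in `𝒯(J)`. -/
def tildeT : MorphismProperty (Sheaf J (Type v)) :=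
  fun F₁ F₂ f => ∃ (X₁ X₂ : C) (H₁ : Subgroup (Aut X₁)) (H₂ : Subgroup (Aut X₂))
    (α₁ : quotientSheaf J H₁ ≅ F₁) (α₂ : quotientSheaf J H₂ ≅ F₂)
    (X' : C) (m : X' ⟶ X₁) (f' : X' ⟶ X₂),
    IsModerate J H₁ ∧ IsModerate J H₂ ∧ typeJ J m ∧ typeJ J f' ∧
      (reprSheaf J).map m ≫ quotientProj J H₁ ≫ α₁.hom ≫ f =
        (reprSheaf J).map f' ≫ quotientProj J H₂ ≫ α₂.hom

end Quotients

section Enlargement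

variable {C : Type u} [Category.{v} C] [EssentiallySmall.{v} C] (J : GrothendieckTopology C)

/-- The choice of a category `C̃`: a full subcategory of the category of sheaves whose objects are
moderate quotients, which is closed under isomorphisms and contains the sheaves associated with
the objects of `C`. -/
structure QuotientEnlargement where
  prop : ObjectProperty (Sheaf J (Type v))
  le_moderate : prop ≤ moderateQuotients J
  reprSheaf_mem : ∀ X : C, prop ((reprSheaf J).obj X)
  of_iso : ∀ ⦃F F' : Sheaf J (Type v)⦄, (F ≅ F') → prop F → prop F'

namespace QuotientEnlargement

variable {J} (E : QuotientEnlargement J)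

/-- The category `C̃`. -/
abbrev Tilde := E.prop.FullSubcategory

/-- `𝒯̃`, as a collection of morphisms in `C̃`. -/
def tildeT : MorphismProperty E.Tilde := fun _ _ f => YSite.tildeT J f.hom

open Classical in
/-- The degree of a morphism `f : X ⟶ Y` in `𝒯̃`: choose `g : Z ⟶ X` in `𝒯̃` such that `f ∘ g` is a
Galois covering in `C̃`, and count the morphisms from `Z` to `X` over `Y`. -/
noncomputable def degree {X Y : E.Tilde} (f : X ⟶ Y) : ℕ :=
  if h : ∃ (Z : E.Tilde) (g : Z ⟶ X), E.tildeT g ∧ IsGaloisCovering (g ≫ f) then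
    Nat.card (HomOver (h.choose_spec.choose ≫ f) f)
  else 0

/-- A presentation of a sheaf as a finite coproduct, in the category of sheaves, of objects
of `C̃`. -/
structure Decomposition (F : Sheaf J (Type v)) where
  n : ℕ
  comp : Fin n → E.Tilde
  incl : ∀ i, (comp i).obj ⟶ F
  isColimit : IsColimit (Cofan.mk F incl)

/-- The finite coproducts of objects of `C̃`. -/
def finiteCoproducts : ObjectProperty (Sheaf J (Type v)) := fun F => Nonempty (E.Decomposition F)

/-- The category `FC̃`. -/
abbrev FC := E.finiteCoproducts.FullSubcategory

/-- An object of `C̃` is an object of `FC̃`. -/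
lemma prop_le_finiteCoproducts : E.prop ≤ E.finiteCoproducts := fun F hF =>
  ⟨{ n := 1
     comp := fun _ => ⟨F, hF⟩
     incl := fun _ => 𝟙 F
     isColimit := Cofan.IsColimit.mk _ (fun s => s.inj 0)
       (fun s i => by
         obtain rfl : i = 0 := Subsingleton.elim _ _
         exact Category.id_comp _)
       (fun s m hm => (Category.id_comp m).symm.trans (hm 0)) }⟩

/-- The inclusion of `C̃` in `FC̃`. -/
abbrev toFC : E.Tilde ⥤ E.FC := ObjectProperty.ιOfLE E.prop_le_finiteCoproducts

/-- The functor from `C` to `FC̃`. -/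
noncomputable def fromC : C ⥤ E.FC :=
  E.finiteCoproducts.lift (reprSheaf J)
    (fun X => E.prop_le_finiteCoproducts _ (E.reprSheaf_mem X))

/-- The Grothendieck topology on `FC̃`. -/
noncomputable def topology : GrothendieckTopology E.FC := pushforwardTopology E.fromC J

variable {E}

/-- The decomposition of an object of `FC̃` into its connected components. -/
noncomputable def decomposition (F : E.FC) : E.Decomposition F.obj := F.property.some

/-- The set `π₀(F)` of connected components of an object of `FC̃`. -/
abbrev piZero (F : E.FC) : Type := Fin (decomposition F).n

/-- The component of `F` at `i`, an object of `C̃`. -/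
noncomputable abbrev component (F : E.FC) (i : piZero F) : E.Tilde := (decomposition F).comp i

/-- The inclusion of the component of `F` at `i`, a morphism of `FC̃`. -/
noncomputable def componentIncl (F : E.FC) (i : piZero F) :
    E.toFC.obj (component F i) ⟶ F := ObjectProperty.homMk ((decomposition F).incl i)

/-- `g` is the component of `f : F ⟶ F'` at `i`, and `π₀(f)` sends `i` to `j`. (For given `f`, `i`
there is exactly one such pair `(j, g)`, as the components are connected.) -/
def IsComponentAt {F F' : E.FC} (f : F ⟶ F') (i : piZero F) (j : piZero F')
    (g : component F i ⟶ component F' j) : Prop :=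
  componentIncl F i ≫ f = E.toFC.map g ≫ componentIncl F' j

/-- The collection `FT̃`: the morphisms of `FC̃` all of whose components are in `𝒯̃`. -/
def FT : MorphismProperty E.FC := fun F F' f =>
  ∀ i : piZero F, ∃ (j : piZero F') (g : component F i ⟶ component F' j),
    IsComponentAt f i j g ∧ E.tildeT g

open Classical in
/-- The degree of a morphism `f : F ⟶ F'` in `FT̃`: the function on `π₀(F')` whose value at `j` is
the sum of the degrees of the components of `f` at the `i` with `π₀(f)(i) = j`. -/
noncomputable def degreeFC {F F' : E.FC} (f : F ⟶ F') (j : piZero F') : ℕ :=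
  ∑ i : piZero F,
    if h : ∃ g : component F i ⟶ component F' j, IsComponentAt f i j g then E.degree h.choose
    else 0

/-- A structure of abelian presheaf with transfers on a presheaf `G` of abelian groups on `FC̃`. -/
structure TransferStructure (G : E.FCᵒᵖ ⥤ AddCommGrpCat.{w}) where
  /-- `G` sends an initial object to the trivial group -/
  initial : ∀ F : E.FC, IsInitial F → Subsingleton (G.obj (op F))
  /-- `G` sends finite coproducts to products -/
  coproduct : ∀ (I : Type) [Finite I] (N : I → E.FC) (c : Cofan N), IsColimit c →
    Function.Bijective (fun (x : G.obj (op c.pt)) (i : I) => (G.map (c.inj i).op).hom x)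
  /-- the transfer homomorphism `f_*` -/
  push : ∀ ⦃F F' : E.FC⦄ (f : F ⟶ F'), FT f → (G.obj (op F) ⟶ G.obj (op F'))
  /-- `(f ∘ f')_* = f_* ∘ f'_*`; the composite is again in `FT̃` -/
  push_comp : ∀ ⦃F F' F'' : E.FC⦄ (f' : F ⟶ F') (f : F' ⟶ F'') (hf' : FT f') (hf : FT f),
    ∃ h : FT (f' ≫ f), push (f' ≫ f) h = push f' hf' ≫ push f hf
  /-- base change: for a cartesian square with `f'` in `FT̃`, the morphism `f` is again in `FT̃` and
  `g₂^* ∘ f'_* = f_* ∘ g₁^*` -/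
  base_change : ∀ ⦃F₁ F₁' F₂ F₂' : E.FC⦄ (g₁ : F₁ ⟶ F₁') (f : F₁ ⟶ F₂) (f' : F₁' ⟶ F₂')
    (g₂ : F₂ ⟶ F₂'), IsPullback g₁ f f' g₂ → ∀ hf' : FT f',
    ∃ hf : FT f, push f' hf' ≫ G.map g₂.op = G.map g₁.op ≫ push f hf
  /-- `f_* ∘ f^*` is the multiplication by the degree of `f` -/
  push_pull : ∀ ⦃F F' : E.FC⦄ (f : F ⟶ F') (hf : FT f) (j : piZero F') (x : G.obj (op F')),
    (G.map (componentIncl F' j).op).hom ((push f hf).hom ((G.map f.op).hom x)) =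
      degreeFC f j • (G.map (componentIncl F' j).op).hom x

/-- The underlying presheaf of abelian groups of a presheaf of rings on `FC̃`. -/
abbrev underlyingAb (G : E.FCᵒᵖ ⥤ RingCat.{w}) : E.FCᵒᵖ ⥤ AddCommGrpCat.{w} :=
  G ⋙ forget₂ RingCat.{w} AddCommGrpCat.{w}

/-- The transfer homomorphism `f_*` for a presheaf of rings, as a map between the rings. -/
def TransferStructure.pushRing {G : E.FCᵒᵖ ⥤ RingCat.{w}} (t : TransferStructure (underlyingAb G))
    {F F' : E.FC} (f : F ⟶ F') (hf : FT f) : G.obj (op F) →+ G.obj (op F') :=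
  (t.push f hf).hom

/-- A structure of presheaf of rings with transfers on a presheaf `G` of rings on `FC̃`: a structure
of abelian presheaf with transfers on the underlying presheaf of abelian groups which satisfies
the projection formula on both sides. -/
structure RingTransferStructure (G : E.FCᵒᵖ ⥤ RingCat.{w}) extends
    TransferStructure (underlyingAb G) where
  /-- `f_*(x · f^* y) = f_*(x) · y` -/
  projection_right : ∀ ⦃F F' : E.FC⦄ (f : F ⟶ F') (hf : FT f)
    (x : G.obj (op F)) (y : G.obj (op F')),
    toTransferStructure.pushRing f hf (x * (G.map f.op).hom y) =
      toTransferStructure.pushRing f hf x * y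
  /-- `f_*(f^* y · x) = y · f_*(x)` -/
  projection_left : ∀ ⦃F F' : E.FC⦄ (f : F ⟶ F') (hf : FT f)
    (x : G.obj (op F)) (y : G.obj (op F')),
    toTransferStructure.pushRing f hf ((G.map f.op).hom y * x) =
      y * toTransferStructure.pushRing f hf x

end QuotientEnlargement

end Enlargement

end YSite

/-!
A morphism `f : F ⟶ F'` of `FC̃` is called finite locally constant when, locally on `F'` for the
topology of `C`, it becomes a finite disjoint sum of copies of the base. A morphism `a` from a test
object, i.e. an object of `C`, to `F'` which achieves this is said to split `f`; the copies are then
indexed by the lifts `s` of `a` through `f`. The proof rests on two facts.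

* The members of `FT̃` are the finite locally constant morphisms (`FT_iff`), and the degree of `f`
  at a component is the number of lifts of any splitting morphism to this component
  (`degreeFC_eq_card`). For a morphism `X₁ / H₁ ⟶ X₂ / H₂` represented by `X₁ ⟵ X' ⟶ X₂`, with
  `H₂ ⊆ Aut_Y(X₂)`, a splitting is given by any `Z ⟶ X'` such that `Z ⟶ X' ⟶ X₂ ⟶ Y` is a Galois
  covering: each lift comes from an automorphism of `Z` over `Y`
  (`IsQuotientMap.exists_endomorphism`). The converse uses that `f ∘ g` is in `𝒯(J)` only if `f` and
  `g` are. As all the morphisms of `C` are epimorphisms, the restriction maps of the quotients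
  `X / H` are injective, and the lifts can be compared after any restriction.
* For a sheaf `G` and a finite locally constant `f`, the formula `a^* (f_* x) = ∑ s^* x`, the sum
  being over the lifts `s` of the splitting morphism `a`, defines a homomorphism `f_*` by descent
  (`trace`). The identities required of transfers hold since they hold after applying
  every such `a^*`; the behaviour on coproducts is a consequence of the sheaf property.

Conversely, the axioms force this formula (`TransferStructure.push_eq_trace`). By base change along
a splitting `a`, it suffices to treat the codiagonal `∐ X ⟶ X`. There, base change along the
inclusions `i_s` of the components, which are disjoint monomorphisms, gives `i_s^* i_{s*} = id` and
`i_r^* i_{s*} = 0` for `r ≠ s`; thus every `y` is the sum of the `i_{s*} i_s^* y`, and its transfer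
to `X` is the sum of the `i_s^* y`.
-/

universe v₁ u₁

namespace YSite

/-! ### Finite locally constant morphisms -/

section Splitting

variable {C : Type u} [Category.{v} C] {D : Type u₁} [Category.{v₁} D]

/-- Precomposition with `b`, from the morphisms over `a` to the morphisms over `b ≫ a`. -/
def HomOver.precomp {F F' V W : D} {f : F ⟶ F'} {a : V ⟶ F'} (b : W ⟶ V) (s : HomOver a f) :
    HomOver (b ≫ a) f :=
  ⟨b ≫ s.1, by rw [Category.assoc, s.2]⟩

/-- `a : V ⟶ F'` splits `f : F ⟶ F'`, relatively to a functor `ρ` whose values play the role of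
test objects: over `V`, the morphism `f` is a finite disjoint sum of copies of `V`. This is
expressed by the lifts of `a` through `f`, which are finite in number and account for all the
lifts of the restrictions of `a` to the test objects. -/
structure Splits (ρ : C ⥤ D) {F F' V : D} (f : F ⟶ F') (a : V ⟶ F') : Prop where
  finite : Finite (HomOver a f)
  bijective : ∀ ⦃W : C⦄ (b : ρ.obj W ⟶ V),
    Function.Bijective (HomOver.precomp b : HomOver a f → HomOver (b ≫ a) f)

variable {ρ : C ⥤ D}

lemma Splits.precomp {F F' V : D} {f : F ⟶ F'} {a : V ⟶ F'} (h : Splits ρ f a) {W : C}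
    (b : ρ.obj W ⟶ V) : Splits ρ f (b ≫ a) where
  finite := have := h.finite; Finite.of_surjective _ (h.bijective b).2
  bijective W' b' := by
    have h₁ := h.bijective (b' ≫ b)
    have h₂ := h.bijective b
    constructor
    · intro s s' hs
      obtain ⟨s, rfl⟩ := h₂.2 s
      obtain ⟨s', rfl⟩ := h₂.2 s'
      have : s = s' := h₁.1 (Subtype.ext (by
        simpa [HomOver.precomp] using congrArg Subtype.val hs))
      rw [this]
    · rintro ⟨s, hs⟩
      obtain ⟨s₀, hs₀⟩ := h₁.2 ⟨s, by simpa using hs⟩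
      exact ⟨HomOver.precomp b s₀, Subtype.ext (by
        simpa [HomOver.precomp] using congrArg Subtype.val hs₀)⟩

/-- The sieve of the morphisms `b : W ⟶ X` along which the pullback of `a` splits `f`. -/
def splitSieve {F F' : D} (f : F ⟶ F') {X : C} (a : ρ.obj X ⟶ F') : Sieve X where
  arrows _ b := Splits ρ f (ρ.map b ≫ a)
  downward_closed := fun h g => by
    rw [ρ.map_comp, Category.assoc]
    exact h.precomp _

/-- `f` becomes a finite disjoint sum of copies of the base, locally on the base. -/
def IsFiniteLocallyConstant (J : GrothendieckTopology C) (ρ : C ⥤ D) {F F' : D} (f : F ⟶ F') :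
    Prop :=
  ∀ (X : C) (a : ρ.obj X ⟶ F'), splitSieve f a ∈ J X

variable {J : GrothendieckTopology C}

/-- A section of a sheaf for the pushforward topology is determined by its values at the test
objects, locally. -/
lemma eq_of_locally_eq {P : Dᵒᵖ ⥤ Type w} (hP : Presieve.IsSheaf (pushforwardTopology ρ J) P)
    {F : D} {y y' : P.obj (op F)}
    (h : ∀ (X : C) (a : ρ.obj X ⟶ F), ∃ R ∈ J X, ∀ ⦃W : C⦄ (b : W ⟶ X), R b →
      P.map (ρ.map b ≫ a).op y = P.map (ρ.map b ≫ a).op y') : y = y' := by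
  let S : Sieve F :=
    { arrows := fun _ g => P.map g.op y = P.map g.op y'
      downward_closed := fun {_ _ g} hg k => by
        simp only [op_comp, P.map_comp, types_comp_apply]
        rw [hg] }
  have hS : S ∈ pushforwardTopology ρ J F := by
    intro X a
    obtain ⟨R, hR, hR'⟩ := h X a
    exact J.superset_covering (fun W b hb => hR' b hb) hR
  exact (hP S hS).isSeparatedFor.ext (fun _ g hg => hg)

/-- The lifts of `a` through `f' ≫ f` are the lifts through `f'` of its lifts through `f`. -/
lemma splits_comp_of_splits {F F' F'' V : D} {f' : F ⟶ F'} {f : F' ⟶ F''} {a : V ⟶ F''}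
    (h : Splits ρ f a) (h' : ∀ s : HomOver a f, Splits ρ f' s.1) : Splits ρ (f' ≫ f) a where
  finite := by
    have := h.finite
    have := fun s => (h' s).finite
    refine Finite.of_injective (β := Σ s : HomOver a f, HomOver s.1 f')
      (fun t => ⟨⟨t.1 ≫ f', by rw [Category.assoc, t.2]⟩, ⟨t.1, rfl⟩⟩) ?_
    rintro ⟨t, ht⟩ ⟨t', ht'⟩ e
    simp only [Sigma.mk.injEq, Subtype.mk.injEq] at e
    obtain ⟨e₁, e₂⟩ := e
    refine Subtype.ext ?_
    have : ∀ (c c' : V ⟶ F') (hc : t ≫ f' = c) (hc' : t' ≫ f' = c'), c = c' →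
        HEq (⟨t, hc⟩ : HomOver c f') (⟨t', hc'⟩ : HomOver c' f') → t = t' := by
      rintro c _ hc hc' rfl he
      exact congrArg Subtype.val (eq_of_heq he)
    exact this _ _ rfl rfl e₁ e₂
  bijective W b := by
    constructor
    · rintro ⟨t, ht⟩ ⟨t', ht'⟩ e
      have e : b ≫ t = b ≫ t' := congrArg Subtype.val e
      have e₁ : t ≫ f' = t' ≫ f' := congrArg Subtype.val <|
        (h.bijective b).1 (a₁ := ⟨t ≫ f', by rw [Category.assoc, ht]⟩)
          (a₂ := ⟨t' ≫ f', by rw [Category.assoc, ht']⟩)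
          (Subtype.ext (by simp [HomOver.precomp, reassoc_of% e]))
      have e₂ := congrArg Subtype.val <|
        ((h' ⟨t ≫ f', by rw [Category.assoc, ht]⟩).bijective b).1
          (a₁ := ⟨t, rfl⟩) (a₂ := ⟨t', e₁.symm⟩) (Subtype.ext e)
      exact Subtype.ext e₂
    · rintro ⟨t, ht⟩
      obtain ⟨s, hs⟩ := (h.bijective b).2 ⟨t ≫ f', by rw [Category.assoc, ht]⟩
      obtain ⟨r, hr⟩ := ((h' s).bijective b).2 ⟨t, (congrArg Subtype.val hs).symm⟩
      exact ⟨⟨r.1, by rw [← Category.assoc, r.2, s.2]⟩,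
        Subtype.ext (congrArg Subtype.val hr :)⟩

lemma exists_covering_forall {X : C} {ι : Type*} [Finite ι] (S : ι → Sieve X)
    (hS : ∀ i, S i ∈ J X) : ∃ R ∈ J X, ∀ i, R ≤ S i := by
  classical
  have := Fintype.ofFinite ι
  have key : ∀ s : Finset ι, ∃ R ∈ J X, ∀ i ∈ s, R ≤ S i := by
    intro s
    induction s using Finset.induction_on with
    | empty => exact ⟨⊤, J.top_mem X, by simp⟩
    | insert i s _ ih =>
      obtain ⟨R, hR, hR'⟩ := ih
      refine ⟨R ⊓ S i, J.intersection_covering hR (hS i), fun k hk => ?_⟩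
      rcases Finset.mem_insert.1 hk with rfl | hk
      · exact inf_le_right
      · exact inf_le_left.trans (hR' k hk)
  obtain ⟨R, hR, hR'⟩ := key Finset.univ
  exact ⟨R, hR, fun i => hR' i (Finset.mem_univ i)⟩

/-- Locally on `X`, the morphism `a` splits `f`, and the finitely many lifts of `a` through `f`
split `f'`. -/
lemma exists_covering_splits {F F' F'' : D} {f' : F ⟶ F'} {f : F' ⟶ F''}
    (hf' : IsFiniteLocallyConstant J ρ f') (hf : IsFiniteLocallyConstant J ρ f)
    {X : C} (a : ρ.obj X ⟶ F'') :
    ∃ R ∈ J X, ∀ ⦃W : C⦄ (b : W ⟶ X), R b → Splits ρ f (ρ.map b ≫ a) ∧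
      ∀ s : HomOver (ρ.map b ≫ a) f, Splits ρ f' s.1 := by
  let R : Sieve X :=
    { arrows := fun W b => Splits ρ f (ρ.map b ≫ a) ∧
        ∀ s : HomOver (ρ.map b ≫ a) f, Splits ρ f' s.1
      downward_closed := by
        rintro W W' b ⟨h₁, h₂⟩ g
        rw [ρ.map_comp, Category.assoc]
        refine ⟨h₁.precomp _, fun s => ?_⟩
        obtain ⟨s, rfl⟩ := (h₁.bijective _).2 s
        exact (h₂ s).precomp _ }
  refine ⟨R, J.transitive (hf X a) R fun W b hb => ?_, fun W b hb => hb⟩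
  have hb : Splits ρ f (ρ.map b ≫ a) := hb
  have := hb.finite
  obtain ⟨R', hR', hR''⟩ := exists_covering_forall
    (fun s : HomOver (ρ.map b ≫ a) f => splitSieve f' s.1) (fun s => hf' W s.1)
  refine J.superset_covering (fun W' b' hb' => ?_) hR'
  change Splits ρ f (ρ.map (b' ≫ b) ≫ a) ∧ ∀ s : HomOver (ρ.map (b' ≫ b) ≫ a) f, Splits ρ f' s.1
  rw [ρ.map_comp, Category.assoc]
  refine ⟨hb.precomp _, fun s => ?_⟩
  obtain ⟨s, rfl⟩ := (hb.bijective _).2 s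
  exact hR'' s _ hb'

lemma IsFiniteLocallyConstant.comp {F F' F'' : D} {f' : F ⟶ F'} {f : F' ⟶ F''}
    (hf' : IsFiniteLocallyConstant J ρ f') (hf : IsFiniteLocallyConstant J ρ f) :
    IsFiniteLocallyConstant J ρ (f' ≫ f) := fun X a => by
  obtain ⟨R, hR, hR'⟩ := exists_covering_splits hf' hf a
  exact J.superset_covering (fun W b hb => splits_comp_of_splits (hR' b hb).1 (hR' b hb).2) hR

/-- In a cartesian square, the lifts of `a` through one side are the lifts of `a ≫ g₂` through
the opposite side. -/
noncomputable def homOverPullbackEquiv {F₁ F₁' F₂ F₂' V : D} {g₁ : F₁ ⟶ F₁'} {f : F₁ ⟶ F₂}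
    {f' : F₁' ⟶ F₂'} {g₂ : F₂ ⟶ F₂'} (sq : IsPullback g₁ f f' g₂) (a : V ⟶ F₂) :
    HomOver a f ≃ HomOver (a ≫ g₂) f' where
  toFun s := ⟨s.1 ≫ g₁, by rw [Category.assoc, sq.w, ← Category.assoc, s.2]⟩
  invFun s := ⟨sq.lift s.1 a s.2, by simp⟩
  left_inv s := Subtype.ext (sq.hom_ext (by simp) (by simp [s.2]))
  right_inv s := Subtype.ext (by simp)

lemma Splits.of_isPullback {F₁ F₁' F₂ F₂' V : D} {g₁ : F₁ ⟶ F₁'} {f : F₁ ⟶ F₂}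
    {f' : F₁' ⟶ F₂'} {g₂ : F₂ ⟶ F₂'} (sq : IsPullback g₁ f f' g₂) {a : V ⟶ F₂}
    (h : Splits ρ f' (a ≫ g₂)) : Splits ρ f a where
  finite := have := h.finite; Finite.of_equiv _ (homOverPullbackEquiv sq a).symm
  bijective W b := by
    constructor
    · intro s s' e
      have e : b ≫ s.1 = b ≫ s'.1 := congrArg Subtype.val e
      refine (homOverPullbackEquiv sq a).injective ((h.bijective b).1 (Subtype.ext ?_))
      simp [HomOver.precomp, homOverPullbackEquiv, reassoc_of% e]
    · rintro ⟨s, hs⟩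
      obtain ⟨t, ht⟩ := (h.bijective b).2 ⟨s ≫ g₁, by
        rw [Category.assoc, sq.w, ← Category.assoc, hs, Category.assoc]⟩
      have ht : b ≫ t.1 = s ≫ g₁ := congrArg Subtype.val ht
      refine ⟨(homOverPullbackEquiv sq a).symm t, Subtype.ext (sq.hom_ext ?_ ?_)⟩
      · simp [HomOver.precomp, homOverPullbackEquiv, ht]
      · simp [HomOver.precomp, homOverPullbackEquiv, hs]

lemma IsFiniteLocallyConstant.of_isPullback {F₁ F₁' F₂ F₂' : D} {g₁ : F₁ ⟶ F₁'} {f : F₁ ⟶ F₂}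
    {f' : F₁' ⟶ F₂'} {g₂ : F₂ ⟶ F₂'} (sq : IsPullback g₁ f f' g₂)
    (hf' : IsFiniteLocallyConstant J ρ f') : IsFiniteLocallyConstant J ρ f := fun X a =>
  J.superset_covering (fun W b hb => Splits.of_isPullback sq (by
    rw [Category.assoc]; exact hb)) (hf' X (a ≫ g₂))

/-! ### Traces for sheaves of abelian groups -/

section Trace

variable {G : Dᵒᵖ ⥤ AddCommGrpCat.{w}}

/-- The sum of the pullbacks of `x` along the lifts of `a` through `f`. -/
noncomputable def traceSum (G : Dᵒᵖ ⥤ AddCommGrpCat.{w}) {F F' V : D} (f : F ⟶ F') (a : V ⟶ F')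
    (x : G.obj (op F)) : G.obj (op V) :=
  ∑ᶠ s : HomOver a f, (G.map s.1.op).hom x

lemma traceSum_add {F F' V : D} {f : F ⟶ F'} {a : V ⟶ F'} (h : Splits ρ f a)
    (x x' : G.obj (op F)) : traceSum G f a (x + x') = traceSum G f a x + traceSum G f a x' := by
  have := h.finite
  simp only [traceSum, map_add]
  exact finsum_add_distrib (Set.toFinite _) (Set.toFinite _)

lemma map_traceSum {F F' V V' : D} {f : F ⟶ F'} {a : V ⟶ F'} [Finite (HomOver a f)]
    (b : V' ⟶ V) (x : G.obj (op F)) :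
    (G.map b.op).hom (traceSum G f a x) = ∑ᶠ s : HomOver a f, (G.map (b ≫ s.1).op).hom x := by
  rw [traceSum, AddMonoidHom.map_finsum _ (Set.toFinite _)]
  simp

/-- Restricting the trace sum to a test object. -/
lemma map_traceSum_of_splits {F F' V : D} {f : F ⟶ F'} {a : V ⟶ F'} (h : Splits ρ f a)
    {W : C} (b : ρ.obj W ⟶ V) (x : G.obj (op F)) :
    (G.map b.op).hom (traceSum G f a x) = traceSum G f (b ≫ a) x := by
  have := h.finite
  rw [map_traceSum]
  exact finsum_eq_of_bijective _ (h.bijective b) (fun _ => rfl)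

lemma sheaf_ext (hG : Presieve.IsSheaf (pushforwardTopology ρ J) (G ⋙ forget AddCommGrpCat.{w}))
    {F : D} {y y' : G.obj (op F)}
    (h : ∀ (X : C) (a : ρ.obj X ⟶ F), ∃ R ∈ J X, ∀ ⦃W : C⦄ (b : W ⟶ X), R b →
      (G.map (ρ.map b ≫ a).op).hom y = (G.map (ρ.map b ≫ a).op).hom y') : y = y' :=
  eq_of_locally_eq hG h

/-- The trace sums at the splitting morphisms glue. -/
lemma existsUnique_trace
    (hG : Presieve.IsSheaf (pushforwardTopology ρ J) (G ⋙ forget AddCommGrpCat.{w}))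
    {F F' : D} {f : F ⟶ F'} (hf : IsFiniteLocallyConstant J ρ f) (x : G.obj (op F)) :
    ∃! y : G.obj (op F'), ∀ (X : C) (a : ρ.obj X ⟶ F'), Splits ρ f a →
      (G.map a.op).hom y = traceSum G f a x := by
  let I := {p : Σ X : C, (ρ.obj X ⟶ F') // Splits ρ f p.2}
  let X : I → D := fun p => ρ.obj p.1.1
  let π : ∀ p : I, X p ⟶ F' := fun p => p.1.2
  have hcov : Sieve.generate (Presieve.ofArrows X π) ∈ pushforwardTopology ρ J F' := by
    intro Y a
    refine J.superset_covering (fun W b hb => ?_) (hf Y a)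
    exact ⟨_, 𝟙 _, _, Presieve.ofArrows.mk (⟨⟨W, ρ.map b ≫ a⟩, hb⟩ : I), by simp [π]⟩
  have hs := (Presieve.isSheafFor_iff_generate _).2 (hG _ hcov)
  rw [Presieve.isSheafFor_arrows_iff] at hs
  obtain ⟨y, hy, hy'⟩ := hs (fun p => (traceSum G f p.1.2 x : G.obj (op (ρ.obj p.1.1)))) (by
    intro p q Z gp gq hpq
    refine eq_of_locally_eq hG fun Y a => ⟨⊤, J.top_mem Y, fun W b _ => ?_⟩
    change (G.map (ρ.map b ≫ a).op).hom ((G.map gp.op).hom (traceSum G f p.1.2 x)) =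
      (G.map (ρ.map b ≫ a).op).hom ((G.map gq.op).hom (traceSum G f q.1.2 x))
    simp only [← AddCommGrpCat.comp_apply, ← G.map_comp, ← op_comp]
    erw [map_traceSum_of_splits p.2, map_traceSum_of_splits q.2]
    have : ((ρ.map b ≫ a) ≫ gp) ≫ p.1.2 = ((ρ.map b ≫ a) ≫ gq) ≫ q.1.2 := by
      rw [Category.assoc, hpq, ← Category.assoc]
    rw [this])
  exact ⟨y, fun X a ha => hy ⟨⟨X, a⟩, ha⟩, fun y' h => hy' y' fun p => h _ _ p.2⟩

lemma eq_of_splits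
    (hG : Presieve.IsSheaf (pushforwardTopology ρ J) (G ⋙ forget AddCommGrpCat.{w}))
    {F F' : D} {f : F ⟶ F'} (hf : IsFiniteLocallyConstant J ρ f)
    {y y' : G.obj (op F')} (h : ∀ (X : C) (a : ρ.obj X ⟶ F'), Splits ρ f a →
      (G.map a.op).hom y = (G.map a.op).hom y') : y = y' :=
  sheaf_ext hG fun X a => ⟨_, hf X a, fun _ _ hb => h _ _ hb⟩

variable (hG : Presieve.IsSheaf (pushforwardTopology ρ J) (G ⋙ forget AddCommGrpCat.{w}))

/-- The transfer along a finite locally constant morphism. -/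
noncomputable def trace {F F' : D} {f : F ⟶ F'} (hf : IsFiniteLocallyConstant J ρ f) :
    G.obj (op F) ⟶ G.obj (op F') :=
  AddCommGrpCat.ofHom (AddMonoidHom.mk' (fun x => (existsUnique_trace hG hf x).choose) (by
    intro x x'
    refine eq_of_splits hG hf fun X a ha => ?_
    rw [map_add, (existsUnique_trace hG hf _).choose_spec.1 X a ha,
      (existsUnique_trace hG hf _).choose_spec.1 X a ha,
      (existsUnique_trace hG hf _).choose_spec.1 X a ha, traceSum_add ha]))

lemma map_trace {F F' : D} {f : F ⟶ F'} (hf : IsFiniteLocallyConstant J ρ f) {X : C}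
    {a : ρ.obj X ⟶ F'} (ha : Splits ρ f a) (x : G.obj (op F)) :
    (G.map a.op).hom ((trace hG hf).hom x) = traceSum G f a x :=
  (existsUnique_trace hG hf x).choose_spec.1 X a ha

/-- Both sides sum over the lifts through `f' ≫ f`; on the right, they are grouped by their image in
`F'`. -/
lemma trace_comp {F F' F'' : D} {f' : F ⟶ F'} {f : F' ⟶ F''}
    (hf' : IsFiniteLocallyConstant J ρ f') (hf : IsFiniteLocallyConstant J ρ f) :
    trace hG (hf'.comp hf) = trace hG hf' ≫ trace hG hf := by
  ext x
  refine sheaf_ext hG fun X a => ?_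
  obtain ⟨R, hR, hR'⟩ := exists_covering_splits hf' hf a
  refine ⟨R, hR, fun W b hb => ?_⟩
  obtain ⟨h, h'⟩ := hR' b hb
  generalize ρ.map b ≫ a = c at h h'
  have := h.finite
  have := fun s => (h' s).finite
  have := (splits_comp_of_splits h h').finite
  rw [map_trace hG _ (splits_comp_of_splits h h'), AddCommGrpCat.hom_comp,
    AddMonoidHom.comp_apply, map_trace hG _ h, traceSum, traceSum]
  simp_rw [map_trace hG hf' (h' _), traceSum]
  classical
  have := Fintype.ofFinite (HomOver c f)
  have := fun s : HomOver c f => Fintype.ofFinite (HomOver s.1 f')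
  have := Fintype.ofFinite (HomOver c (f' ≫ f))
  simp_rw [finsum_eq_sum_of_fintype]
  rw [← Finset.sum_fiberwise_of_maps_to (s := Finset.univ) (t := Finset.univ)
    (g := fun t : HomOver c (f' ≫ f) => (⟨t.1 ≫ f', by rw [Category.assoc, t.2]⟩ : HomOver c f))
    (fun _ _ => Finset.mem_univ _)]
  refine Finset.sum_congr rfl fun s _ => ?_
  refine Finset.sum_bij' (fun t ht => ⟨t.1, congrArg Subtype.val (Finset.mem_filter.1 ht).2⟩)
    (fun t _ => ⟨t.1, by rw [← Category.assoc, t.2, s.2]⟩) ?_ ?_ ?_ ?_ ?_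
  · intros; exact Finset.mem_univ _
  · intro t _
    exact Finset.mem_filter.2 ⟨Finset.mem_univ _, Subtype.ext t.2⟩
  all_goals intros; rfl

lemma trace_base_change {F₁ F₁' F₂ F₂' : D} {g₁ : F₁ ⟶ F₁'} {f : F₁ ⟶ F₂}
    {f' : F₁' ⟶ F₂'} {g₂ : F₂ ⟶ F₂'} (sq : IsPullback g₁ f f' g₂)
    (hf' : IsFiniteLocallyConstant J ρ f') :
    trace hG hf' ≫ G.map g₂.op = G.map g₁.op ≫ trace hG (hf'.of_isPullback sq) := by
  ext x
  refine sheaf_ext hG fun X a => ⟨_, hf' X (a ≫ g₂), fun W b hb => ?_⟩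
  have hb : Splits ρ f' ((ρ.map b ≫ a) ≫ g₂) := by rw [Category.assoc]; exact hb
  generalize ρ.map b ≫ a = c at hb
  rw [AddCommGrpCat.hom_comp, AddMonoidHom.comp_apply, AddCommGrpCat.hom_comp,
    AddMonoidHom.comp_apply, map_trace hG _ (hb.of_isPullback sq), ← AddMonoidHom.comp_apply,
    ← AddCommGrpCat.hom_comp, ← G.map_comp, ← op_comp, map_trace hG _ hb]
  symm
  refine finsum_eq_of_bijective _ (homOverPullbackEquiv sq c).bijective fun s => ?_
  rw [← AddMonoidHom.comp_apply, ← AddCommGrpCat.hom_comp, ← G.map_comp, ← op_comp]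
  rfl

/-- The composite of the pullback and the transfer multiplies by the number of lifts. -/
lemma map_trace_map {F F' : D} {f : F ⟶ F'} (hf : IsFiniteLocallyConstant J ρ f) {X : C}
    {a : ρ.obj X ⟶ F'} (ha : Splits ρ f a) (x : G.obj (op F')) :
    (G.map a.op).hom ((trace hG hf).hom ((G.map f.op).hom x)) =
      Nat.card (HomOver a f) • (G.map a.op).hom x := by
  have := ha.finite
  rw [map_trace hG hf ha, traceSum]
  have : ∀ s : HomOver a f, (G.map s.1.op).hom ((G.map f.op).hom x) = (G.map a.op).hom x := by
    intro s
    rw [← AddMonoidHom.comp_apply, ← AddCommGrpCat.hom_comp, ← G.map_comp, ← op_comp, s.2]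
  simp_rw [this]
  have := Fintype.ofFinite (HomOver a f)
  rw [finsum_eq_sum_of_fintype, Finset.sum_const, Finset.card_univ, Nat.card_eq_fintype_card]

lemma eq_trace {F F' : D} {f : F ⟶ F'} (hf : IsFiniteLocallyConstant J ρ f)
    (φ : G.obj (op F) ⟶ G.obj (op F'))
    (h : ∀ (X : C) (a : ρ.obj X ⟶ F'), Splits ρ f a → ∀ x,
      (G.map a.op).hom (φ.hom x) = traceSum G f a x) : φ = trace hG hf := by
  ext x
  exact eq_of_splits hG hf fun X a ha => by rw [h X a ha x, map_trace hG hf ha]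

end Trace

end Splitting

/-! ### The collection `𝒯(J)` -/

section TypeJ

variable {C : Type u} [Category.{v} C] {J : GrothendieckTopology C}

lemma covering_of_typeJ {X Y : C} {f : Y ⟶ X} (hf : typeJ J f) {R : Sieve X} (h : R f) : R ∈ J X :=
  J.superset_covering ((Sieve.generate_le_iff _ _).2 (by rintro _ _ ⟨⟩; exact h)) hf

namespace IsBSite

variable (hJ : IsBSite J)
include hJ

lemma exists_typeJ {X : C} {R : Sieve X} (hR : R ∈ J X) :
    ∃ (Y : C) (f : Y ⟶ X), typeJ J f ∧ R f := by
  obtain ⟨T, -, hT⟩ := hJ.isATopology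
  obtain ⟨Y, f, hf, hRf⟩ := (hT X R).1 hR
  exact ⟨Y, f, (hT X _).2 ⟨Y, f, hf, Sieve.le_generate _ _ _ (Presieve.singleton_self f)⟩, hRf⟩

lemma typeJ_comp {X Y Z : C} {f : X ⟶ Y} {g : Y ⟶ Z} (hf : typeJ J f) (hg : typeJ J g) :
    typeJ J (f ≫ g) :=
  (hJ.comp_mem_iff f g).2 ⟨hf, hg⟩

/-- The collection `𝒯(J)` has the completion property of semi-localizing collections. -/
lemma square {X Y₁ Y₂ : C} (f₁ : Y₁ ⟶ X) (f₂ : Y₂ ⟶ X) (h₁ : typeJ J f₁) :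
    ∃ (Z : C) (g₁ : Z ⟶ Y₁) (g₂ : Z ⟶ Y₂), typeJ J g₂ ∧ g₁ ≫ f₁ = g₂ ≫ f₂ := by
  obtain ⟨Z, g₂, hg₂, W, g₁, _, ⟨⟩, e⟩ := hJ.exists_typeJ (J.pullback_stable f₂ h₁)
  exact ⟨Z, g₁, g₂, hg₂, e⟩

end IsBSite

lemma typeJ_id (X : C) : typeJ J (𝟙 X) := by
  have : Sieve.generate (Presieve.singleton (𝟙 X)) = ⊤ :=
    (Sieve.id_mem_iff_eq_top).1 (Sieve.le_generate _ _ _ (Presieve.singleton_self _))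
  rw [typeJ, this]
  exact J.top_mem X

end TypeJ

/-! ### Sections of sheaves as morphisms from represented sheaves -/

section Sections

variable {C : Type u} [Category.{v} C] [EssentiallySmall.{v} C] {J : GrothendieckTopology C}

instance wEqualsLocallyBijective : J.WEqualsLocallyBijective (Type v) :=
  have : HasSheafify ((equivSmallModel.{v} C).inverse.inducedTopology J) (Type v) := inferInstance
  GrothendieckTopology.WEqualsLocallyBijective.ofEssentiallySmall.{v} J

/-- The morphisms from the sheaf represented by `X` to `F` are the sections of `F` over `X`. -/
noncomputable def reprEquiv {X : C} {F : Sheaf J (Type v)} :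
    ((reprSheaf J).obj X ⟶ F) ≃ F.obj.obj (op X) :=
  ((sheafificationAdjunction J (Type v)).homEquiv _ _).trans yonedaEquiv

lemma reprEquiv_map_comp {X Y : C} {F : Sheaf J (Type v)} (b : Y ⟶ X)
    (a : (reprSheaf J).obj X ⟶ F) :
    reprEquiv ((reprSheaf J).map b ≫ a) = F.obj.map b.op (reprEquiv a) :=
  (congrArg yonedaEquiv ((sheafificationAdjunction J (Type v)).homEquiv_naturality_left
    (yoneda.map b) a)).trans (yonedaEquiv_naturality _ _).symm

lemma reprEquiv_comp {X : C} {F F' : Sheaf J (Type v)} (a : (reprSheaf J).obj X ⟶ F)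
    (f : F ⟶ F') : reprEquiv (a ≫ f) = f.hom.app (op X) (reprEquiv a) :=
  (congrArg yonedaEquiv ((sheafificationAdjunction J (Type v)).homEquiv_naturality_right
    a f)).trans (yonedaEquiv_comp _ _)

lemma reprEquiv_presheafToSheaf_map {X : C} {P : Cᵒᵖ ⥤ Type v} (g : yoneda.obj X ⟶ P) :
    reprEquiv (J := J) ((presheafToSheaf J (Type v)).map g) =
      (toSheafify J P).app (op X) (yonedaEquiv g) := by
  rw [← yonedaEquiv_comp, toSheafify_naturality]
  exact congrArg yonedaEquiv (Adjunction.homEquiv_unit _ _ _ _)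

/-- Sheaves are separated. -/
lemma repr_hom_ext {X : C} {F : Sheaf J (Type v)} {a a' : (reprSheaf J).obj X ⟶ F} {R : Sieve X}
    (hR : R ∈ J X) (h : ∀ ⦃W : C⦄ (t : W ⟶ X), R t →
      (reprSheaf J).map t ≫ a = (reprSheaf J).map t ≫ a') : a = a' := by
  apply reprEquiv.injective
  refine (((isSheaf_iff_isSheaf_of_type J _).1 F.property) R hR).isSeparatedFor.ext fun W t ht => ?_
  rw [← reprEquiv_map_comp, ← reprEquiv_map_comp, h t ht]

lemma repr_hom_ext_typeJ {X W : C} {F : Sheaf J (Type v)} {a a' : (reprSheaf J).obj X ⟶ F}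
    {t : W ⟶ X} (ht : typeJ J t) (h : (reprSheaf J).map t ≫ a = (reprSheaf J).map t ≫ a') :
    a = a' :=
  repr_hom_ext ht (by
    rintro Z _ ⟨Y, g, _, ⟨⟩, rfl⟩
    simp only [Functor.map_comp, Category.assoc, h])

lemma sheaf_hom_ext {F F' : Sheaf J (Type v)} {φ ψ : F ⟶ F'}
    (h : ∀ (X : C) (a : (reprSheaf J).obj X ⟶ F), a ≫ φ = a ≫ ψ) : φ = ψ := by
  ext X x
  obtain ⟨a, rfl⟩ := reprEquiv.surjective x
  have := congrArg reprEquiv (h X.unop a)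
  rwa [reprEquiv_comp, reprEquiv_comp] at this

/-- A morphism of sheaves can be defined by its action on sections. -/
lemma exists_sheaf_hom {F F' : Sheaf J (Type v)}
    (φ : ∀ X : C, ((reprSheaf J).obj X ⟶ F) → ((reprSheaf J).obj X ⟶ F'))
    (hφ : ∀ (X Y : C) (b : Y ⟶ X) (a : (reprSheaf J).obj X ⟶ F),
      φ Y ((reprSheaf J).map b ≫ a) = (reprSheaf J).map b ≫ φ X a) :
    ∃ f : F ⟶ F', ∀ (X : C) (a : (reprSheaf J).obj X ⟶ F), a ≫ f = φ X a := by
  refine ⟨ObjectProperty.homMk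
    { app := fun X => TypeCat.ofHom fun x => reprEquiv (φ X.unop (reprEquiv.symm x))
      naturality := ?_ }, fun X a => ?_⟩
  · intro X Y b
    ext x
    obtain ⟨a, rfl⟩ := reprEquiv.surjective x
    change reprEquiv (φ Y.unop (reprEquiv.symm (F.obj.map b (reprEquiv a)))) =
      F'.obj.map b (reprEquiv (φ X.unop (reprEquiv.symm (reprEquiv a))))
    have h₁ := reprEquiv_map_comp b.unop a
    have h₂ := reprEquiv_map_comp b.unop (φ X.unop a)
    rw [Quiver.Hom.op_unop] at h₁ h₂
    erw [← h₁, Equiv.symm_apply_apply, Equiv.symm_apply_apply, ← h₂, hφ]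
  · apply reprEquiv.injective
    rw [reprEquiv_comp]
    change reprEquiv (φ X (reprEquiv.symm (reprEquiv a))) = _
    rw [Equiv.symm_apply_apply]

/-- A morphism of sheaves factors through `m` if its values do, and do so uniquely. -/
lemma exists_sheaf_lift {F F' F'' : Sheaf J (Type v)} (φ : F ⟶ F') (m : F'' ⟶ F')
    (hm : ∀ (X : C) (a a' : (reprSheaf J).obj X ⟶ F''), a ≫ m = a' ≫ m → a = a')
    (h : ∀ (X : C) (a : (reprSheaf J).obj X ⟶ F), ∃ a' : (reprSheaf J).obj X ⟶ F'',
      a' ≫ m = a ≫ φ) : ∃ ψ : F ⟶ F'', ψ ≫ m = φ := by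
  choose ψ hψ using h
  obtain ⟨f, hf⟩ := exists_sheaf_hom ψ (fun X Y b a => hm _ _ _ (by
    rw [hψ, Category.assoc, Category.assoc, hψ]))
  exact ⟨f, sheaf_hom_ext fun X a => by rw [← Category.assoc, hf, hψ]⟩

end Sections

/-! ### Quotient sheaves -/

section QuotientMap

variable {C : Type u} [Category.{v} C] [EssentiallySmall.{v} C]

/-- `q` exhibits `F` as the quotient of the sheaf represented by `X` by the action of `H`:
it is invariant and locally surjective, and two morphisms to `X` with the same composite with `q`
differ by an element of `H`. -/
structure IsQuotientMap (J : GrothendieckTopology C) {X : C} (H : Subgroup (Aut X))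
    {F : Sheaf J (Type v)} (q : (reprSheaf J).obj X ⟶ F) : Prop where
  invariant : ∀ h ∈ H, (reprSheaf J).map h.hom ≫ q = q
  lift : ∀ ⦃W : C⦄ (a : (reprSheaf J).obj W ⟶ F), ∃ (W' : C) (t : W' ⟶ W) (c : W' ⟶ X),
    typeJ J t ∧ (reprSheaf J).map t ≫ a = (reprSheaf J).map c ≫ q
  exists_eq : ∀ ⦃W : C⦄ (c c' : W ⟶ X), (reprSheaf J).map c ≫ q = (reprSheaf J).map c' ≫ q →
    ∃ h ∈ H, c ≫ h.hom = c'

variable {J : GrothendieckTopology C}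

lemma map_comp_quotientProj {X W : C} (H : Subgroup (Aut X)) (c : W ⟶ X) :
    (reprSheaf J).map c ≫ quotientProj J H =
      (presheafToSheaf J (Type v)).map (yoneda.map c ≫ quotientPresheafProj H) :=
  ((presheafToSheaf J (Type v)).map_comp _ _).symm

lemma reprEquiv_map_comp_quotientProj {X W : C} (H : Subgroup (Aut X)) (c : W ⟶ X) :
    reprEquiv ((reprSheaf J).map c ≫ quotientProj J H) =
      (toSheafify J (quotientPresheaf H)).app (op W) (Quotient.mk (orbitSetoid H W) c) := by
  rw [map_comp_quotientProj]
  refine (reprEquiv_presheafToSheaf_map _).trans ?_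
  congr 1
  rw [yonedaEquiv_apply]
  change Quotient.mk (orbitSetoid H W) (𝟙 W ≫ c) = _
  rw [Category.id_comp]

/-- This is the local bijectivity of the sheafification of `H \ Hom(-, X)`. -/
lemma isQuotientMap_quotientProj (hJ : IsBSite J) {X : C} (H : Subgroup (Aut X)) :
    IsQuotientMap J H (quotientProj J H) where
  invariant h hh := by
    apply reprEquiv.injective
    rw [reprEquiv_map_comp_quotientProj]
    have e := reprEquiv_map_comp_quotientProj (J := J) H (𝟙 X)
    rw [(reprSheaf J).map_id, Category.id_comp] at e
    rw [e]
    congr 1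
    exact Quotient.sound ⟨h⁻¹, H.inv_mem hh, h.hom_inv_id⟩
  lift W a := by
    obtain ⟨W', t, ht, p, hp⟩ := hJ.exists_typeJ
      (Presheaf.imageSieve_mem J (toSheafify J (quotientPresheaf H)) (U := op W) (reprEquiv a))
    induction p using Quotient.inductionOn with | _ c
    refine ⟨W', t, c, ht, reprEquiv.injective ?_⟩
    rw [reprEquiv_map_comp, reprEquiv_map_comp_quotientProj]
    exact hp.symm
  exists_eq W c c' e := by
    have e := congrArg reprEquiv e
    rw [reprEquiv_map_comp_quotientProj, reprEquiv_map_comp_quotientProj] at e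
    obtain ⟨W', t, ht, e'⟩ := hJ.exists_typeJ
      (Presheaf.equalizerSieve_mem J (toSheafify J (quotientPresheaf H)) (X := op W) _ _ e)
    obtain ⟨h, hh, e''⟩ := Quotient.exact (s := orbitSetoid H W') (a := t ≫ c) (b := t ≫ c') e'
    have := hJ.epi t
    exact ⟨h, hh, by rwa [Category.assoc, cancel_epi] at e''⟩

lemma IsQuotientMap.comp_iso {X : C} {H : Subgroup (Aut X)} {F F' : Sheaf J (Type v)}
    {q : (reprSheaf J).obj X ⟶ F} (hq : IsQuotientMap J H q) (α : F ≅ F') :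
    IsQuotientMap J H (q ≫ α.hom) where
  invariant h hh := by rw [← Category.assoc, hq.invariant h hh]
  lift W a := by
    obtain ⟨W', t, c, ht, e⟩ := hq.lift (a ≫ α.inv)
    exact ⟨W', t, c, ht, by rw [← reassoc_of% e]; simp⟩
  exists_eq W c c' e := hq.exists_eq c c' (by
    simpa only [← Category.assoc, cancel_mono] using e)

/-- The sheaf represented by `X` is the quotient by the trivial group. -/
noncomputable def quotientSheafBotIso (J : GrothendieckTopology C) (X : C) :
    quotientSheaf J (⊥ : Subgroup (Aut X)) ≅ (reprSheaf J).obj X :=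
  (presheafToSheaf J (Type v)).mapIso
    { hom :=
        { app := fun U => TypeCat.ofHom (Quotient.lift id (by
            rintro a _ ⟨h, hh, rfl⟩
            obtain rfl := Subgroup.mem_bot.1 hh
            exact (Category.comp_id a).symm))
          naturality := fun U V g => by
            ext x
            induction x using Quotient.inductionOn
            rfl }
      inv := quotientPresheafProj ⊥
      hom_inv_id := by
        ext U x
        induction x using Quotient.inductionOn
        rfl
      inv_hom_id := by
        ext U x
        rfl }

lemma quotientProj_bot_comp (X : C) :
    quotientProj J (⊥ : Subgroup (Aut X)) ≫ (quotientSheafBotIso J X).hom = 𝟙 _ :=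
  (quotientSheafBotIso J X).inv_hom_id

lemma isQuotientMap_id (hJ : IsBSite J) (X : C) :
    IsQuotientMap J (⊥ : Subgroup (Aut X)) (𝟙 ((reprSheaf J).obj X)) := by
  rw [← quotientProj_bot_comp]
  exact (isQuotientMap_quotientProj hJ _).comp_iso _

omit [EssentiallySmall.{v} C] in
lemma isModerate_bot (X : C) : IsModerate J (⊥ : Subgroup (Aut X)) :=
  ⟨X, 𝟙 X, typeJ_id X, fun h hh => by
    obtain rfl := Subgroup.mem_bot.1 hh
    exact Category.comp_id _⟩

variable (hJ : IsBSite J)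
include hJ

/-- A morphism between represented sheaves is represented locally. -/
lemma exists_repr_lift {X W : C} (b : (reprSheaf J).obj W ⟶ (reprSheaf J).obj X) :
    ∃ (W' : C) (t : W' ⟶ W) (c : W' ⟶ X), typeJ J t ∧
      (reprSheaf J).map t ≫ b = (reprSheaf J).map c := by
  simpa using (isQuotientMap_id hJ X).lift b

lemma IsQuotientMap.lift₂ {X : C} {H : Subgroup (Aut X)} {F : Sheaf J (Type v)}
    {q : (reprSheaf J).obj X ⟶ F} (hq : IsQuotientMap J H q) {W : C}
    (a a' : (reprSheaf J).obj W ⟶ F) : ∃ (W' : C) (t : W' ⟶ W) (c c' : W' ⟶ X),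
      typeJ J t ∧ (reprSheaf J).map t ≫ a = (reprSheaf J).map c ≫ q ∧
        (reprSheaf J).map t ≫ a' = (reprSheaf J).map c' ≫ q := by
  obtain ⟨W₁, t₁, c₁, ht₁, e₁⟩ := hq.lift a
  obtain ⟨W₂, t₂, c₂, ht₂, e₂⟩ := hq.lift ((reprSheaf J).map t₁ ≫ a')
  exact ⟨W₂, t₂ ≫ t₁, t₂ ≫ c₁, c₂, hJ.typeJ_comp ht₂ ht₁, by simp [e₁], by simp [← e₂]⟩

omit hJ in
/-- The restriction maps of `F` are injective, all of them. -/
def HasInjectiveRestrictions (F : Sheaf J (Type v)) : Prop :=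
  ∀ ⦃W X : C⦄ (b : (reprSheaf J).obj W ⟶ (reprSheaf J).obj X) (s s' : (reprSheaf J).obj X ⟶ F),
    b ≫ s = b ≫ s' → s = s'

/-- As all the morphisms of `C` are epimorphisms, quotients have injective restriction maps. -/
lemma IsQuotientMap.hasInjectiveRestrictions {X : C} {H : Subgroup (Aut X)} {F : Sheaf J (Type v)}
    {q : (reprSheaf J).obj X ⟶ F} (hq : IsQuotientMap J H q) : HasInjectiveRestrictions F := by
  intro W X₀ b s s' e
  obtain ⟨W, t₀, b', ht₀, e₀⟩ := exists_repr_lift hJ b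
  obtain ⟨Y, t, c, c', ht, e₁, e₂⟩ := hq.lift₂ hJ s s'
  obtain ⟨Z, g₁, g₂, hg₂, e₃⟩ := hJ.square t b' ht
  obtain ⟨h, hh, e₄⟩ := hq.exists_eq (g₁ ≫ c) (g₁ ≫ c') (by
    rw [Functor.map_comp, Category.assoc, ← e₁, Functor.map_comp, Category.assoc, ← e₂,
      ← Functor.map_comp_assoc, ← Functor.map_comp_assoc, e₃, Functor.map_comp_assoc,
      Functor.map_comp_assoc, ← e₀, Category.assoc, Category.assoc, e])
  have := hJ.epi g₁
  rw [Category.assoc, cancel_epi] at e₄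
  refine repr_hom_ext_typeJ ht ?_
  rw [e₁, e₂, ← e₄, Functor.map_comp, Category.assoc, hq.invariant h hh]

end QuotientMap

/-! ### The collection `𝒯̃` and finite locally constant morphisms -/

section TildeT

variable {C : Type u} [Category.{v} C] [EssentiallySmall.{v} C] {J : GrothendieckTopology C}

lemma moderateQuotients.exists_isQuotientMap (hJ : IsBSite J) {F : Sheaf J (Type v)}
    (hF : moderateQuotients J F) : ∃ (X : C) (H : Subgroup (Aut X)) (q : (reprSheaf J).obj X ⟶ F),
      IsModerate J H ∧ IsQuotientMap J H q := by
  obtain ⟨X, H, hH, ⟨α⟩⟩ := hF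
  exact ⟨X, H, _, hH, (isQuotientMap_quotientProj hJ H).comp_iso α⟩

lemma moderateQuotients.hasInjectiveRestrictions (hJ : IsBSite J) {F : Sheaf J (Type v)}
    (hF : moderateQuotients J F) : HasInjectiveRestrictions F := by
  obtain ⟨X, H, q, -, hq⟩ := moderateQuotients.exists_isQuotientMap hJ hF
  exact hq.hasInjectiveRestrictions hJ

section Representative

variable {X₁ X₂ X' : C} {H₁ : Subgroup (Aut X₁)} {H₂ : Subgroup (Aut X₂)}
  {F₁ F₂ : Sheaf J (Type v)} {q₁ : (reprSheaf J).obj X₁ ⟶ F₁} {q₂ : (reprSheaf J).obj X₂ ⟶ F₂}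
  {f : F₁ ⟶ F₂} {m : X' ⟶ X₁} {f' : X' ⟶ X₂}

/-- Precomposing a quotient map with a member of `𝒯(J)` leaves it locally surjective. -/
lemma IsQuotientMap.lift_of_typeJ (hJ : IsBSite J) (hq₁ : IsQuotientMap J H₁ q₁)
    (hm : typeJ J m) {W : C} (s : (reprSheaf J).obj W ⟶ F₁) :
    ∃ (W' : C) (t : W' ⟶ W) (c : W' ⟶ X'), typeJ J t ∧
      (reprSheaf J).map t ≫ s = (reprSheaf J).map (c ≫ m) ≫ q₁ := by
  obtain ⟨W₁, t₁, c₁, ht₁, e₁⟩ := hq₁.lift s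
  obtain ⟨W₂, g₁, g₂, hg₂, e₂⟩ := hJ.square m c₁ hm
  exact ⟨W₂, g₂ ≫ t₁, g₁, hJ.typeJ_comp hg₂ ht₁, by
    rw [e₂, Functor.map_comp, Category.assoc, e₁, Functor.map_comp, Category.assoc]⟩

/-- Let `Z ⟶ X' ⟶ X₂ ⟶ Y` be a Galois covering, where `H₂ ⊆ Aut_Y(X₂)`. Then each lift through `f`
of a morphism to `F₂` which factors through `Z` is induced by an automorphism of `Z` over `Y`. -/
lemma IsQuotientMap.exists_endomorphism (hJ : IsBSite J)
    (hq₁ : IsQuotientMap J H₁ q₁) (hq₂ : IsQuotientMap J H₂ q₂) (hm : typeJ J m)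
    (e : (reprSheaf J).map m ≫ q₁ ≫ f = (reprSheaf J).map f' ≫ q₂)
    {Y Z : C} {p : X₂ ⟶ Y} (hp : ∀ h ∈ H₂, h.hom ≫ p = p) {g : Z ⟶ X'} (hg : typeJ J g)
    (hgal : IsGaloisCovering (g ≫ f' ≫ p)) {W : C}
    (b : (reprSheaf J).obj W ⟶ (reprSheaf J).obj Z)
    (s : (reprSheaf J).obj W ⟶ F₁) (hs : s ≫ f = b ≫ (reprSheaf J).map (g ≫ f') ≫ q₂) :
    ∃ γ : HomOver (g ≫ f' ≫ p) (g ≫ f' ≫ p),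
      ((reprSheaf J).map (γ.1 ≫ g ≫ m) ≫ q₁) ≫ f = (reprSheaf J).map (g ≫ f') ≫ q₂ ∧
        b ≫ (reprSheaf J).map (γ.1 ≫ g ≫ m) ≫ q₁ = s := by
  obtain ⟨W₁, t₁, b₁, ht₁, e₁⟩ := exists_repr_lift hJ b
  obtain ⟨W₂, t₂, c, ht₂, e₂⟩ := hq₁.lift_of_typeJ hJ (hJ.typeJ_comp hg hm)
    ((reprSheaf J).map t₁ ≫ s)
  -- `c` and `t₂ ≫ b₁` induce the same section of `F₂`, hence have the same composite to `Y`
  obtain ⟨h, hh, e₃⟩ := hq₂.exists_eq (c ≫ g ≫ f') (t₂ ≫ b₁ ≫ g ≫ f') (by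
    have := congrArg (fun k => k ≫ f) e₂
    simp only [Functor.map_comp, Category.assoc, hs, reassoc_of% e₁, e] at this
    simp only [Functor.map_comp, Category.assoc, this])
  obtain ⟨γ, ⟨hγ, e₄⟩, -⟩ := hgal (t₂ ≫ b₁) c (by
    have := congrArg (fun k => k ≫ p) e₃
    simp only [Category.assoc, hp h hh] at this
    simp only [Category.assoc, this])
  have key : b ≫ (reprSheaf J).map (γ.hom ≫ g ≫ m) ≫ q₁ = s := by
    refine repr_hom_ext_typeJ (hJ.typeJ_comp ht₂ ht₁) ?_
    simp only [Functor.map_comp, Category.assoc] at e₂ ⊢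
    rw [e₂, reassoc_of% e₁, ← e₄]
    simp only [Functor.map_comp, Category.assoc]
  exact ⟨⟨γ.hom, hγ⟩, hq₂.hasInjectiveRestrictions hJ b _ _ (by
    rw [← hs, ← key]; simp only [Category.assoc]), key⟩

lemma IsQuotientMap.splits_of_isGaloisCovering (hJ : IsBSite J)
    (hq₁ : IsQuotientMap J H₁ q₁) (hq₂ : IsQuotientMap J H₂ q₂) (hm : typeJ J m)
    (e : (reprSheaf J).map m ≫ q₁ ≫ f = (reprSheaf J).map f' ≫ q₂)
    {Y Z : C} {p : X₂ ⟶ Y} (hp : ∀ h ∈ H₂, h.hom ≫ p = p) {g : Z ⟶ X'} (hg : typeJ J g)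
    (hgal : IsGaloisCovering (g ≫ f' ≫ p))
    (hfin : Finite (HomOver (g ≫ f' ≫ p) (g ≫ f' ≫ p))) :
    Splits (reprSheaf J) f ((reprSheaf J).map (g ≫ f') ≫ q₂) where
  finite := by
    have key := fun s : HomOver ((reprSheaf J).map (g ≫ f') ≫ q₂) f =>
      hq₁.exists_endomorphism hJ hq₂ hm e hp hg hgal (𝟙 _) s.1 (by rw [s.2, Category.id_comp])
    choose γ hγ hγ' using key
    refine Finite.of_injective γ fun s s' h => Subtype.ext ?_
    rw [← hγ' s, ← hγ' s', h]
  bijective W b := by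
    constructor
    · intro s s' h
      exact Subtype.ext (hq₁.hasInjectiveRestrictions hJ b _ _ (congrArg Subtype.val h))
    · rintro ⟨s, hs⟩
      obtain ⟨γ, h₁, h₂⟩ := hq₁.exists_endomorphism hJ hq₂ hm e hp hg hgal b s hs
      exact ⟨⟨_, h₁⟩, Subtype.ext h₂⟩

end Representative

/-- The members of `𝒯̃` are finite locally constant. -/
lemma tildeT.isFiniteLocallyConstant (hJ : IsYSite J) (hfin : HasFiniteOverHoms J)
    {F₁ F₂ : Sheaf J (Type v)} {f : F₁ ⟶ F₂} (hf : tildeT J f) :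
    IsFiniteLocallyConstant J (reprSheaf J) f := by
  obtain ⟨X₁, X₂, H₁, H₂, α₁, α₂, X', m, f', -, ⟨Y, p, hp, hp'⟩, hm, hf', e⟩ := hf
  have hB := hJ.isBSite
  have hq₁ := (isQuotientMap_quotientProj hB H₁).comp_iso α₁
  have hq₂ := (isQuotientMap_quotientProj hB H₂).comp_iso α₂
  have hf'p := hB.typeJ_comp hf' hp
  obtain ⟨Z, g, hg, hgal⟩ := hJ.enough_galois _ hf'p
  have hgf'p := hB.typeJ_comp hg hf'p
  have hs := hq₁.splits_of_isGaloisCovering hB hq₂ hm (by simpa using e) hp' hg hgal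
    (hfin _ _ hgf'p hgf'p)
  intro X a
  obtain ⟨W, t, c, ht, e₁⟩ := hq₂.lift_of_typeJ hB (hB.typeJ_comp hg hf') a
  refine covering_of_typeJ ht ?_
  change Splits _ _ _
  rw [e₁, Functor.map_comp, Category.assoc]
  exact hs.precomp _

/-- A finite locally constant morphism between moderate quotients is in `𝒯̃`. -/
lemma tildeT_of_isFiniteLocallyConstant (hJ : IsBSite J)
    {F₁ F₂ : Sheaf J (Type v)} {f : F₁ ⟶ F₂} (hF₁ : moderateQuotients J F₁)
    (hF₂ : moderateQuotients J F₂) (hf : IsFiniteLocallyConstant J (reprSheaf J) f) :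
    tildeT J f := by
  obtain ⟨X₁, H₁, hH₁, ⟨α₁⟩⟩ := hF₁
  obtain ⟨X₂, H₂, hH₂, ⟨α₂⟩⟩ := hF₂
  have hq₁ := (isQuotientMap_quotientProj hJ H₁).comp_iso α₁
  have hq₂ := (isQuotientMap_quotientProj hJ H₂).comp_iso α₂
  obtain ⟨X', m, f', hm, e⟩ := hq₂.lift ((quotientProj J H₁ ≫ α₁.hom) ≫ f)
  refine ⟨X₁, X₂, H₁, H₂, α₁, α₂, X', m, f', hH₁, hH₂, hm, ?_, by simpa using e⟩
  generalize quotientProj J H₁ ≫ α₁.hom = q₁ at hq₁ e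
  generalize quotientProj J H₂ ≫ α₂.hom = q₂ at hq₂ e
  -- the lift of `q₁` to `X'` extends to a member of `𝒯(J)` over `X₂` which splits `f`
  obtain ⟨X₂', τ, hτ, hsp⟩ := hJ.exists_typeJ (hf X₂ q₂)
  obtain ⟨W, w₂, w₁, hw₁, ew⟩ := hJ.square τ f' hτ
  obtain ⟨⟨s₀, hs₀⟩, hs₀'⟩ := (Splits.bijective hsp ((reprSheaf J).map w₂)).2
    ⟨(reprSheaf J).map (w₁ ≫ m) ≫ q₁, by
      rw [Functor.map_comp, Category.assoc, Category.assoc, e, ← Functor.map_comp_assoc, ← ew,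
        Functor.map_comp_assoc]⟩
  have hs₀' : (reprSheaf J).map w₂ ≫ s₀ = (reprSheaf J).map (w₁ ≫ m) ≫ q₁ :=
    congrArg Subtype.val hs₀'
  obtain ⟨X₃, t, c, ht, et⟩ := hq₁.lift s₀
  obtain ⟨W', u₁, u₂, hu₂, eu⟩ := hJ.square t w₂ ht
  obtain ⟨h, hh, eh⟩ := hq₁.exists_eq (u₁ ≫ c) (u₂ ≫ w₁ ≫ m) (by
    rw [Functor.map_comp_assoc, ← et, ← Functor.map_comp_assoc, eu, Functor.map_comp_assoc, hs₀']
    simp only [Functor.map_comp, Category.assoc])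
  have hu₁ : typeJ J u₁ := ((hJ.comp_mem_iff u₁ (c ≫ h.hom)).1 (by
    rw [← Category.assoc, eh]
    exact hJ.typeJ_comp hu₂ (hJ.typeJ_comp hw₁ hm))).1
  have hcomp : typeJ J ((u₂ ≫ w₁) ≫ f') := by
    rw [Category.assoc, ← ew, ← Category.assoc, ← eu]
    exact hJ.typeJ_comp (hJ.typeJ_comp hu₁ ht) hτ
  exact ((hJ.comp_mem_iff _ _).1 hcomp).2

/-- The members of `𝒯̃` are locally surjective. -/
lemma tildeT.exists_lift (hJ : IsBSite J) {F₁ F₂ : Sheaf J (Type v)} {f : F₁ ⟶ F₂}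
    (hf : tildeT J f) {W : C} (s : (reprSheaf J).obj W ⟶ F₂) :
    ∃ (W' : C) (t : W' ⟶ W) (z : (reprSheaf J).obj W' ⟶ F₁), typeJ J t ∧
      z ≫ f = (reprSheaf J).map t ≫ s := by
  obtain ⟨X₁, X₂, H₁, H₂, α₁, α₂, X', m, f', -, -, hm, hf', e⟩ := hf
  obtain ⟨W', t, c, ht, e'⟩ :=
    ((isQuotientMap_quotientProj hJ H₂).comp_iso α₂).lift_of_typeJ hJ hf' s
  refine ⟨W', t, (reprSheaf J).map (c ≫ m) ≫ quotientProj J H₁ ≫ α₁.hom, ht, ?_⟩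
  rw [e', Functor.map_comp_assoc, Functor.map_comp_assoc, Category.assoc, Category.assoc,
    Category.assoc, e]

/-- All the fibres of a finite locally constant morphism to a connected object have the same
cardinality. -/
lemma IsFiniteLocallyConstant.card_eq (hJ : IsBSite J) {F₁ F₂ : Sheaf J (Type v)} {f : F₁ ⟶ F₂}
    (hF₂ : moderateQuotients J F₂) (hf : IsFiniteLocallyConstant J (reprSheaf J) f)
    {V V' : C} {a : (reprSheaf J).obj V ⟶ F₂} {a' : (reprSheaf J).obj V' ⟶ F₂}
    (ha : Splits (reprSheaf J) f a) (ha' : Splits (reprSheaf J) f a') :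
    Nat.card (HomOver a f) = Nat.card (HomOver a' f) := by
  obtain ⟨X, H, q, -, hq⟩ := moderateQuotients.exists_isQuotientMap hJ hF₂
  obtain ⟨X₂, τ, hτ, hsp⟩ := hJ.exists_typeJ (hf X q)
  have hsp : Splits (reprSheaf J) f ((reprSheaf J).map τ ≫ q) := hsp
  have key : ∀ (V : C) (a : (reprSheaf J).obj V ⟶ F₂), Splits (reprSheaf J) f a →
      Nat.card (HomOver a f) = Nat.card (HomOver ((reprSheaf J).map τ ≫ q) f) := by
    intro V a ha
    obtain ⟨W, t, c, -, e⟩ := hq.lift_of_typeJ hJ hτ a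
    rw [Nat.card_congr (Equiv.ofBijective _ (ha.bijective ((reprSheaf J).map t))),
      Nat.card_congr (Equiv.ofBijective _ (hsp.bijective ((reprSheaf J).map c))), e,
      Functor.map_comp_assoc]
  rw [key _ _ ha, key _ _ ha']

end TildeT

/-! ### Galois coverings and degrees in `C̃` -/

namespace QuotientEnlargement

variable {C : Type u} [Category.{v} C] [EssentiallySmall.{v} C] {J : GrothendieckTopology C}
  {E : QuotientEnlargement J}

/-- The object of `C̃` represented by an object of `C`. -/
noncomputable abbrev reprTilde (E : QuotientEnlargement J) (X : C) : E.Tilde :=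
  ⟨(reprSheaf J).obj X, E.reprSheaf_mem X⟩

/-- There are enough Galois coverings in `C̃`. -/
lemma exists_isGaloisCovering (hJ : IsYSite J) {X Y : E.Tilde} {f : X ⟶ Y} (hf : E.tildeT f) :
    ∃ (Z : E.Tilde) (g : Z ⟶ X), E.tildeT g ∧ IsGaloisCovering (g ≫ f) := by
  obtain ⟨X₁, X₂, H₁, H₂, α₁, α₂, X', m, f', hH₁, ⟨Y₀, p, hp, hp'⟩, hm, hf', e⟩ := hf
  have hB := hJ.isBSite
  have hq₂ := (isQuotientMap_quotientProj hB H₂).comp_iso α₂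
  obtain ⟨Z, g, hg, hgal⟩ := hJ.enough_galois _ (hB.typeJ_comp hf' hp)
  let k : E.reprTilde Z ⟶ X :=
    ObjectProperty.homMk ((reprSheaf J).map (g ≫ m) ≫ quotientProj J H₁ ≫ α₁.hom)
  have hk : (k ≫ f).hom = (reprSheaf J).map (g ≫ f') ≫ quotientProj J H₂ ≫ α₂.hom := by
    change ((reprSheaf J).map (g ≫ m) ≫ quotientProj J H₁ ≫ α₁.hom) ≫ f.hom = _
    simp only [Functor.map_comp, Category.assoc, e]
  refine ⟨E.reprTilde Z, k, ⟨Z, X₁, ⊥, H₁, quotientSheafBotIso J Z, α₁, Z, 𝟙 Z, g ≫ m,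
    isModerate_bot Z, hH₁, typeJ_id Z, hB.typeJ_comp hg hm, ?_⟩, ?_⟩
  · rw [(reprSheaf J).map_id, Category.id_comp, ← Category.assoc, quotientProj_bot_comp,
      Category.id_comp]
    rfl
  intro V h₁ h₂ h
  obtain ⟨XV, HV, qV, -, hqV⟩ :=
    moderateQuotients.exists_isQuotientMap hB (E.le_moderate _ V.property)
  obtain ⟨W, t, c₁, c₂, ht, ec₁, ec₂⟩ :=
    (isQuotientMap_id hB Z).lift₂ hB (qV ≫ h₁.hom) (qV ≫ h₂.hom)
  rw [Category.comp_id] at ec₁ ec₂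
  -- `V` is covered by `W`, over which `h₁` and `h₂` come from morphisms `c₁` and `c₂` of `C`
  have hepi : ∀ {F : Sheaf J (Type v)} (φ ψ : V.obj ⟶ F),
      (reprSheaf J).map t ≫ qV ≫ φ = (reprSheaf J).map t ≫ qV ≫ ψ → φ = ψ := by
    intro F φ ψ e'
    have e' := repr_hom_ext_typeJ ht e'
    refine sheaf_hom_ext fun A a => ?_
    obtain ⟨A', t', c, ht', e''⟩ := hqV.lift a
    refine repr_hom_ext_typeJ ht' ?_
    rw [reassoc_of% e'', reassoc_of% e'', e']
  have hh : h₁.hom ≫ (k ≫ f).hom = h₂.hom ≫ (k ≫ f).hom := congrArg (fun φ => φ.hom) h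
  obtain ⟨η, hη, eη⟩ := hq₂.exists_eq (c₁ ≫ g ≫ f') (c₂ ≫ g ≫ f') (by
    rw [Functor.map_comp_assoc, ← hk, Functor.map_comp_assoc, ← hk, ← ec₁, ← ec₂]
    simp only [Category.assoc, hh])
  obtain ⟨γ, ⟨hγ, eγ⟩, -⟩ := hgal c₁ c₂ (by
    have := congrArg (fun k => k ≫ p) eη
    simp only [Category.assoc, hp' η hη] at this
    exact this)
  have hinj := (isQuotientMap_id hB Z).hasInjectiveRestrictions hB
  let σ : Aut (E.reprTilde Z) := E.prop.isoMk ((reprSheaf J).mapIso γ)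
  have hσ : σ.hom.hom = (reprSheaf J).map γ.hom := rfl
  have e₁ : h₁ ≫ σ.hom = h₂ := by
    ext1
    apply hepi
    change (reprSheaf J).map t ≫ qV ≫ h₁.hom ≫ σ.hom.hom = _
    rw [hσ, reassoc_of% ec₁, ec₂, ← eγ, Functor.map_comp]
  refine ⟨σ, ⟨?_, e₁⟩, ?_⟩
  · ext1
    refine hq₂.hasInjectiveRestrictions hB ((reprSheaf J).map c₁) _ _ ?_
    change (reprSheaf J).map c₁ ≫ σ.hom.hom ≫ (k ≫ f).hom = (reprSheaf J).map c₁ ≫ (k ≫ f).hom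
    rw [hσ, ← Functor.map_comp_assoc, eγ, ← ec₁, ← ec₂, Category.assoc, Category.assoc,
      Category.assoc, Category.assoc, hh]
  · rintro σ' ⟨-, e₂⟩
    refine Iso.ext ?_
    ext1
    refine hinj ((reprSheaf J).map c₁) _ _ ?_
    have : h₁.hom ≫ σ'.hom.hom = h₁.hom ≫ σ.hom.hom :=
      congrArg (fun φ => φ.hom) (e₂.trans e₁.symm)
    rw [← ec₁]
    simp only [Category.assoc, this]

/-- The degree of a member of `𝒯̃` is the cardinality of its fibres. -/
lemma degree_eq_card (hJ : IsYSite J) (hfin : HasFiniteOverHoms J) {X Y : E.Tilde} {f : X ⟶ Y}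
    (hf : E.tildeT f) {V : C} {a : (reprSheaf J).obj V ⟶ Y.obj}
    (ha : Splits (reprSheaf J) f.hom a) : E.degree f = Nat.card (HomOver a f.hom) := by
  have hB := hJ.isBSite
  have h := exists_isGaloisCovering hJ hf
  rw [degree, dif_pos h]
  obtain ⟨hg, hgal⟩ := h.choose_spec.choose_spec
  generalize h.choose_spec.choose = g at hg hgal
  generalize h.choose = Z at g hg hgal
  have hflc := tildeT.isFiniteLocallyConstant hJ hfin hf
  obtain ⟨XZ, HZ, q, -, hq⟩ :=
    moderateQuotients.exists_isQuotientMap hB (E.le_moderate _ Z.property)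
  obtain ⟨W, t, ht, hsp⟩ := hB.exists_typeJ (hflc XZ (q ≫ g.hom ≫ f.hom))
  have hsp : Splits (reprSheaf J) f.hom ((reprSheaf J).map t ≫ q ≫ g.hom ≫ f.hom) := hsp
  -- it suffices to treat a splitting morphism which factors through `g ≫ f`
  rw [hflc.card_eq hB (E.le_moderate _ Y.property) ha hsp]
  refine Nat.card_congr (Equiv.ofBijective (fun s => ⟨(reprSheaf J).map t ≫ q ≫ s.1.hom, by
    have : s.1.hom ≫ f.hom = g.hom ≫ f.hom := congrArg (fun φ => φ.hom) s.2
    simp only [Category.assoc, this]⟩) ⟨?_, ?_⟩)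
  · intro s s' e
    have e := repr_hom_ext_typeJ ht (congrArg Subtype.val e)
    refine Subtype.ext ?_
    ext1
    refine sheaf_hom_ext fun A a => ?_
    obtain ⟨A', t', c, ht', e''⟩ := hq.lift a
    refine repr_hom_ext_typeJ ht' ?_
    rw [reassoc_of% e'', reassoc_of% e'', e]
  · rintro ⟨s, hs⟩
    obtain ⟨W', t', z, ht', ez⟩ := tildeT.exists_lift hB hg s
    -- the sections `z` and `z'` of `Z` over `W'` have the same image in `Y`
    let z₁ : E.reprTilde W' ⟶ Z :=
      ObjectProperty.homMk ((reprSheaf J).map t' ≫ (reprSheaf J).map t ≫ q)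
    let z₂ : E.reprTilde W' ⟶ Z := ObjectProperty.homMk z
    obtain ⟨σ, ⟨hσ, eσ⟩, -⟩ := hgal z₁ z₂ (by
      ext1
      change ((reprSheaf J).map t' ≫ (reprSheaf J).map t ≫ q) ≫ g.hom ≫ f.hom =
        z ≫ g.hom ≫ f.hom
      rw [reassoc_of% ez, hs]
      simp only [Category.assoc])
    refine ⟨⟨σ.hom ≫ g, by rw [Category.assoc, hσ]⟩, Subtype.ext ?_⟩
    refine repr_hom_ext_typeJ ht' ?_
    have eσ : ((reprSheaf J).map t' ≫ (reprSheaf J).map t ≫ q) ≫ σ.hom.hom = z :=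
      congrArg (fun φ => φ.hom) eσ
    change (reprSheaf J).map t' ≫ (reprSheaf J).map t ≫ q ≫ σ.hom.hom ≫ g.hom = _
    rw [← ez, ← eσ]
    simp only [Category.assoc]

end QuotientEnlargement

/-! ### Coproducts on sections -/

section SectionwiseCoproduct

variable {C : Type u} [Category.{v} C] {D : Type u₁} [Category.{v₁} D]

/-- Each morphism from a test object `ρ(X)` to `F` factors through exactly one of the `N i`, in
exactly one way. -/
def IsSectionwiseCoproduct (ρ : C ⥤ D) {ι : Type*} {N : ι → D} {F : D} (incl : ∀ i, N i ⟶ F) :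
    Prop :=
  ∀ (X : C) (a : ρ.obj X ⟶ F), ∃! p : Σ i, (ρ.obj X ⟶ N i), p.2 ≫ incl p.1 = a

namespace IsSectionwiseCoproduct

variable {ρ : C ⥤ D} {ι : Type*} {N : ι → D} {F : D} {incl : ∀ i, N i ⟶ F}
  (h : IsSectionwiseCoproduct ρ incl)
include h

lemma exists_eq {X : C} (a : ρ.obj X ⟶ F) : ∃ (i : ι) (s : ρ.obj X ⟶ N i), s ≫ incl i = a := by
  obtain ⟨⟨i, s⟩, hs, -⟩ := h X a
  exact ⟨i, s, hs⟩

lemma sigma_eq {X : C} {i i' : ι} {s : ρ.obj X ⟶ N i} {s' : ρ.obj X ⟶ N i'}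
    (e : s ≫ incl i = s' ≫ incl i') : (⟨i, s⟩ : Σ i, (ρ.obj X ⟶ N i)) = ⟨i', s'⟩ :=
  (h X (s ≫ incl i)).unique rfl e.symm

lemma index_eq {X : C} {i i' : ι} {s : ρ.obj X ⟶ N i} {s' : ρ.obj X ⟶ N i'}
    (e : s ≫ incl i = s' ≫ incl i') : i = i' :=
  congrArg Sigma.fst (h.sigma_eq e)

lemma hom_eq {X : C} {i : ι} {s s' : ρ.obj X ⟶ N i} (e : s ≫ incl i = s' ≫ incl i) : s = s' :=
  eq_of_heq (Sigma.mk.inj (h.sigma_eq e)).2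

/-- Coproducts of coproducts are coproducts, on sections. -/
lemma sigma {κ : ι → Type*} {M : ∀ i, κ i → D} {incl' : ∀ i k, M i k ⟶ N i}
    (h' : ∀ i, IsSectionwiseCoproduct ρ (incl' i)) :
    IsSectionwiseCoproduct ρ (fun p : Σ i, κ i => incl' p.1 p.2 ≫ incl p.1) := by
  intro X a
  obtain ⟨i, s, rfl⟩ := h.exists_eq a
  obtain ⟨k, r, rfl⟩ := (h' i).exists_eq s
  refine ⟨⟨⟨i, k⟩, r⟩, by simp, ?_⟩
  rintro ⟨⟨i', k'⟩, r'⟩ e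
  dsimp only at e r'
  rw [← Category.assoc] at e
  obtain rfl := h.index_eq e
  have e := h.hom_eq e
  obtain rfl := (h' i').index_eq e
  obtain rfl := (h' i').hom_eq e
  rfl

lemma reindex {κ : Type*} (ε : κ ≃ ι) :
    IsSectionwiseCoproduct ρ (fun k => incl (ε k)) := by
  intro X a
  obtain ⟨i, s, rfl⟩ := h.exists_eq a
  obtain ⟨k, rfl⟩ := ε.surjective i
  refine ⟨⟨k, s⟩, rfl, ?_⟩
  rintro ⟨k', s'⟩ e
  obtain rfl := ε.injective (h.index_eq e)
  obtain rfl := h.hom_eq e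
  rfl

lemma of_iso {F' : D} (α : F ≅ F') : IsSectionwiseCoproduct ρ (fun i => incl i ≫ α.hom) := by
  intro X a
  obtain ⟨p, hp, hp'⟩ := h X (a ≫ α.inv)
  refine ⟨p, by simp [reassoc_of% hp], fun p' e => hp' p' ?_⟩
  simp [← e]

end IsSectionwiseCoproduct

/-- The lifts of a morphism to one component of the target are the lifts through the components of
the source which lie above it. -/
lemma bijective_sigma_homOver {ρ : C ⥤ D} {ι : Type*} {N : ι → D} {F : D} {incl : ∀ i, N i ⟶ F}
    (h : IsSectionwiseCoproduct ρ incl) {F' N' : D} {f : F ⟶ F'} {incl' : N' ⟶ F'}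
    (hincl' : ∀ (X : C) (s s' : ρ.obj X ⟶ N'), s ≫ incl' = s' ≫ incl' → s = s')
    {K : Set ι} (g : ∀ i : K, N i ⟶ N') (hg : ∀ i : K, incl i ≫ f = g i ≫ incl')
    (hK : ∀ i, i ∉ K → ∀ (X : C) (s : ρ.obj X ⟶ N i) (a : ρ.obj X ⟶ N'),
      s ≫ incl i ≫ f ≠ a ≫ incl') {X : C} (a : ρ.obj X ⟶ N') :
    Function.Bijective (fun p : Σ i : K, HomOver a (g i) =>
      (⟨p.2.1 ≫ incl p.1, by rw [Category.assoc, hg, ← Category.assoc, p.2.2]⟩ :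
        HomOver (a ≫ incl') f)) := by
  constructor
  · rintro ⟨⟨i, hi⟩, ⟨s, hs⟩⟩ ⟨⟨i', hi'⟩, ⟨s', hs'⟩⟩ e
    have e : s ≫ incl i = s' ≫ incl i' := congrArg Subtype.val e
    obtain rfl := h.index_eq e
    obtain rfl := h.hom_eq e
    rfl
  · rintro ⟨s, hs⟩
    obtain ⟨i, s, rfl⟩ := h.exists_eq s
    rw [Category.assoc] at hs
    have hi : i ∈ K := by
      by_contra hi
      exact hK i hi X s a hs
    refine ⟨⟨⟨i, hi⟩, s, hincl' _ _ _ ?_⟩, rfl⟩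
    rw [Category.assoc, ← hg ⟨i, hi⟩, hs]

/-- A morphism to a component which splits the components of `f` splits `f`. -/
lemma splits_comp_incl {ρ : C ⥤ D} {ι : Type*} [Finite ι] {N : ι → D} {F : D}
    {incl : ∀ i, N i ⟶ F} (h : IsSectionwiseCoproduct ρ incl)
    {F' N' : D} {f : F ⟶ F'} {incl' : N' ⟶ F'}
    (hincl' : ∀ (X : C) (s s' : ρ.obj X ⟶ N'), s ≫ incl' = s' ≫ incl' → s = s')
    {K : Set ι} (g : ∀ i : K, N i ⟶ N') (hg : ∀ i : K, incl i ≫ f = g i ≫ incl')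
    (hK : ∀ i, i ∉ K → ∀ (X : C) (s : ρ.obj X ⟶ N i) (a : ρ.obj X ⟶ N'),
      s ≫ incl i ≫ f ≠ a ≫ incl') {X : C} {a : ρ.obj X ⟶ N'} (ha : ∀ i, Splits ρ (g i) a) :
    Splits ρ f (a ≫ incl') where
  finite := by
    have := fun i => (ha i).finite
    exact Finite.of_surjective _ (bijective_sigma_homOver h hincl' g hg hK a).2
  bijective W b := by
    constructor
    · intro s s' e
      obtain ⟨⟨i, s⟩, rfl⟩ := (bijective_sigma_homOver h hincl' g hg hK a).2 s
      obtain ⟨⟨i', s'⟩, rfl⟩ := (bijective_sigma_homOver h hincl' g hg hK a).2 s'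
      have e : (b ≫ s.1) ≫ incl i = (b ≫ s'.1) ≫ incl i' := by
        simpa only [HomOver.precomp, Category.assoc] using congrArg Subtype.val e
      obtain rfl : i = i' := Subtype.ext (h.index_eq e)
      obtain rfl : s = s' := ((ha i).bijective b).1 (Subtype.ext (h.hom_eq e))
      rfl
    · rintro ⟨s, hs⟩
      obtain ⟨⟨i, s'⟩, e⟩ := (bijective_sigma_homOver h hincl' g hg hK (b ≫ a)).2
        ⟨s, by rw [hs, Category.assoc]⟩
      have e : s'.1 ≫ incl i = s := congrArg Subtype.val e
      obtain ⟨s₀, hs₀⟩ := ((ha i).bijective b).2 s'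
      refine ⟨⟨s₀.1 ≫ incl i, by rw [Category.assoc, hg, ← Category.assoc, s₀.2]⟩, Subtype.ext ?_⟩
      change b ≫ s₀.1 ≫ incl i = s
      rw [← e, ← hs₀]
      simp only [HomOver.precomp, Category.assoc]

/-- If a morphism to a component splits `f`, it splits the components of `f`. -/
lemma splits_of_splits_comp_incl {ρ : C ⥤ D} {ι : Type*} {N : ι → D} {F : D}
    {incl : ∀ i, N i ⟶ F} (h : IsSectionwiseCoproduct ρ incl)
    {F' N' : D} {f : F ⟶ F'} {incl' : N' ⟶ F'}
    (hincl' : ∀ (X : C) (s s' : ρ.obj X ⟶ N'), s ≫ incl' = s' ≫ incl' → s = s')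
    {i : ι} {g : N i ⟶ N'} (hg : incl i ≫ f = g ≫ incl')
    {X : C} {a : ρ.obj X ⟶ N'} (ha : Splits ρ f (a ≫ incl')) : Splits ρ g a where
  finite := by
    have := ha.finite
    exact Finite.of_injective (β := HomOver (a ≫ incl') f)
      (fun s => ⟨s.1 ≫ incl i, by rw [Category.assoc, hg, ← Category.assoc, s.2]⟩)
      (fun s s' e => Subtype.ext (h.hom_eq (congrArg Subtype.val e)))
  bijective W b := by
    constructor
    · intro s s' e
      have e : b ≫ s.1 = b ≫ s'.1 := congrArg Subtype.val e
      have e' := (ha.bijective b).1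
        (a₁ := ⟨s.1 ≫ incl i, by rw [Category.assoc, hg, ← Category.assoc, s.2]⟩)
        (a₂ := ⟨s'.1 ≫ incl i, by rw [Category.assoc, hg, ← Category.assoc, s'.2]⟩)
        (Subtype.ext (by simp only [HomOver.precomp, reassoc_of% e]))
      exact Subtype.ext (h.hom_eq (congrArg Subtype.val e'))
    · rintro ⟨s, hs⟩
      obtain ⟨⟨s₀, hs₀⟩, e⟩ := (ha.bijective b).2 ⟨s ≫ incl i, by
        rw [Category.assoc, hg, ← Category.assoc, hs, Category.assoc]⟩
      have e : b ≫ s₀ = s ≫ incl i := congrArg Subtype.val e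
      obtain ⟨i', s₀, rfl⟩ := h.exists_eq s₀
      rw [← Category.assoc] at e
      obtain rfl := h.index_eq e
      exact ⟨⟨s₀, hincl' _ _ _ (by rw [← hs₀, Category.assoc, Category.assoc, hg])⟩,
        Subtype.ext (h.hom_eq e)⟩

end SectionwiseCoproduct

/-! ### Coproducts of sheaves -/

section SheafCoproduct

variable {C : Type u} [Category.{v} C] {J : GrothendieckTopology C}

/-- The coproduct of a family of sheaves, as presheaves. -/
def sigmaPresheaf {ι : Type} (N : ι → Sheaf J (Type v)) : Cᵒᵖ ⥤ Type v where
  obj U := Σ i, (N i).obj.obj U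
  map b := TypeCat.ofHom fun x => ⟨x.1, (N x.1).obj.map b x.2⟩
  map_id U := ConcreteCategory.hom_ext _ _ fun ⟨i, x⟩ =>
    congrArg (Sigma.mk i) (show (N i).obj.map (𝟙 U) x = x by simp)
  map_comp b c := ConcreteCategory.hom_ext _ _ fun ⟨i, x⟩ =>
    congrArg (Sigma.mk i)
      (show (N i).obj.map (b ≫ c) x = (N i).obj.map c ((N i).obj.map b x) by simp)

lemma sigmaPresheaf_map_mk {ι : Type} (N : ι → Sheaf J (Type v)) {U V : Cᵒᵖ} (b : U ⟶ V) (i : ι)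
    (x : (N i).obj.obj U) :
    (sigmaPresheaf N).map b ⟨i, x⟩ = ⟨i, (N i).obj.map b x⟩ := rfl

/-- As the covering sieves are generated, up to refinement, by single morphisms which have common
refinements, the coproduct of sheaves in the category of presheaves is a sheaf. -/
lemma isSheaf_sigmaPresheaf (hJ : IsBSite J) {ι : Type} (N : ι → Sheaf J (Type v)) :
    Presieve.IsSheaf J (sigmaPresheaf N) := by
  intro X R hR x hx
  -- the value at one covering morphism `t` determines the component in which all the values lie
  obtain ⟨Y, t, ht, hRt⟩ := hJ.exists_typeJ hR
  obtain ⟨i, xt, ext⟩ : ∃ (i : ι) (xt : (N i).obj.obj (op Y)), x t hRt = ⟨i, xt⟩ := ⟨_, _, rfl⟩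
  have key : ∀ ⦃W : C⦄ (r : W ⟶ X) (hr : R r), ∃ y : (N i).obj.obj (op W), x r hr = ⟨i, y⟩ := by
    intro W r hr
    obtain ⟨Z, g₁, g₂, -, e⟩ := hJ.square t r ht
    have h := hx g₁ g₂ hRt hr e
    rcases hxr : x r hr with ⟨i', y⟩
    rw [ext, hxr] at h
    obtain rfl : i = i' := congrArg Sigma.fst h
    exact ⟨y, rfl⟩
  choose y hy using key
  have hN := (isSheaf_iff_isSheaf_of_type J _).1 (N i).property R hR
  have inj : ∀ {W : C} (z z' : (N i).obj.obj (op W)),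
      (⟨i, z⟩ : Σ i, (N i).obj.obj (op W)) = ⟨i, z'⟩ → z = z' :=
    fun z z' h => eq_of_heq (Sigma.mk.inj h).2
  obtain ⟨z, hz, hz'⟩ := hN (fun W r hr => y r hr) (by
    intro W₁ W₂ Z g₁ g₂ r₁ r₂ h₁ h₂ e
    have h := hx g₁ g₂ h₁ h₂ e
    rw [hy, hy] at h
    exact inj _ _ h)
  refine ⟨⟨i, z⟩, fun W r hr => ?_, ?_⟩
  · rw [hy, sigmaPresheaf_map_mk, hz r hr]
  · rintro ⟨i', z'⟩ h
    have h₀ := h t hRt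
    rw [ext, sigmaPresheaf_map_mk] at h₀
    obtain rfl : i' = i := congrArg Sigma.fst h₀
    congr 1
    refine hz' _ fun W r hr => inj _ _ ?_
    rw [← hy, ← h r hr]
    rfl

/-- The coproduct of a family of sheaves on a `B`-site. -/
def sigmaSheaf (hJ : IsBSite J) {ι : Type} (N : ι → Sheaf J (Type v)) : Sheaf J (Type v) :=
  ⟨sigmaPresheaf N, (isSheaf_iff_isSheaf_of_type J _).2 (isSheaf_sigmaPresheaf hJ N)⟩

/-- The inclusion of a component. -/
def sigmaSheafIncl (hJ : IsBSite J) {ι : Type} (N : ι → Sheaf J (Type v)) (i : ι) :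
    N i ⟶ sigmaSheaf hJ N :=
  ObjectProperty.homMk
    { app := fun _ => TypeCat.ofHom fun x => ⟨i, x⟩
      naturality := fun _ _ _ => rfl }

variable [EssentiallySmall.{v} C]

lemma isSectionwiseCoproduct_sigmaSheafIncl (hJ : IsBSite J) {ι : Type}
    (N : ι → Sheaf J (Type v)) :
    IsSectionwiseCoproduct (reprSheaf J) (sigmaSheafIncl hJ N) := by
  have key : ∀ {X : C} (i : ι) (s : (reprSheaf J).obj X ⟶ N i),
      reprEquiv (s ≫ sigmaSheafIncl hJ N i) = (⟨i, reprEquiv s⟩ : Σ i, (N i).obj.obj (op X)) :=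
    fun i s => reprEquiv_comp _ _
  intro X a
  obtain ⟨i, x, e⟩ : ∃ (i : ι) (x : (N i).obj.obj (op X)),
    reprEquiv a = (⟨i, x⟩ : Σ i, (N i).obj.obj (op X)) := ⟨_, _, rfl⟩
  refine ⟨⟨i, reprEquiv.symm x⟩, reprEquiv.injective ?_, ?_⟩
  · rw [key, e, Equiv.apply_symm_apply]
  · rintro ⟨i', s⟩ rfl
    rw [key] at e
    obtain rfl : i' = i := congrArg Sigma.fst e
    obtain rfl := eq_of_heq (Sigma.mk.inj e).2
    rw [Equiv.symm_apply_apply]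

/-- A cofan of sheaves which is a coproduct on sections is a coproduct. -/
lemma IsSectionwiseCoproduct.nonempty_isColimit {ι : Type*} {N : ι → Sheaf J (Type v)}
    {F : Sheaf J (Type v)} {incl : ∀ i, N i ⟶ F}
    (h : IsSectionwiseCoproduct (reprSheaf J) incl) : Nonempty (IsColimit (Cofan.mk F incl)) := by
  have key : ∀ s : Cofan N, ∃ φ : F ⟶ s.pt, ∀ i, incl i ≫ φ = s.inj i := by
    intro s
    choose p hp hp' using h
    obtain ⟨φ, hφ⟩ := exists_sheaf_hom (F := F) (F' := s.pt)
      (fun X a => (p X a).2 ≫ s.inj (p X a).1) (fun X Y b a => by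
        rw [← hp' Y ((reprSheaf J).map b ≫ a) ⟨(p X a).1, (reprSheaf J).map b ≫ (p X a).2⟩
          (by simp only [Category.assoc, hp])]
        simp only [Category.assoc])
    refine ⟨φ, fun i => sheaf_hom_ext fun X a => ?_⟩
    rw [← Category.assoc, hφ, ← hp' X (a ≫ incl i) ⟨i, a⟩ rfl]
  choose φ hφ using key
  refine ⟨Cofan.IsColimit.mk _ φ hφ fun s m hm => sheaf_hom_ext fun X a => ?_⟩
  obtain ⟨i, a, rfl⟩ := h.exists_eq a
  rw [Category.assoc, Category.assoc, hφ, ← hm]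
  rfl

lemma isSectionwiseCoproduct_of_isColimit (hJ : IsBSite J) {ι : Type}
    {N : ι → Sheaf J (Type v)} {c : Cofan N} (hc : IsColimit c) :
    IsSectionwiseCoproduct (reprSheaf J) c.inj := by
  have h := isSectionwiseCoproduct_sigmaSheafIncl hJ N
  obtain ⟨hc'⟩ := h.nonempty_isColimit
  have := h.of_iso (hc'.coconePointUniqueUpToIso hc)
  have e : ∀ i, sigmaSheafIncl hJ N i ≫ (hc'.coconePointUniqueUpToIso hc).hom = c.inj i :=
    fun i => hc'.comp_coconePointUniqueUpToIso_hom hc ⟨i⟩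
  simpa only [e] using this

/-- A moderate quotient is connected: a morphism to a coproduct factors through a component. -/
lemma exists_factor_of_moderate (hJ : IsBSite J) {F F' : Sheaf J (Type v)}
    (hF : moderateQuotients J F) {ι : Type*} {N : ι → Sheaf J (Type v)} {incl : ∀ i, N i ⟶ F'}
    (h : IsSectionwiseCoproduct (reprSheaf J) incl) (φ : F ⟶ F') :
    ∃ (j : ι) (g : F ⟶ N j), φ = g ≫ incl j := by
  obtain ⟨X, H, q, -, hq⟩ := moderateQuotients.exists_isQuotientMap hJ hF
  obtain ⟨j, a, ea⟩ := h.exists_eq (q ≫ φ)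
  obtain ⟨g, hg⟩ := exists_sheaf_lift φ (incl j) (fun _ _ _ => h.hom_eq) (fun V s => by
    obtain ⟨j', s', es'⟩ := h.exists_eq (s ≫ φ)
    obtain ⟨W, t, c, -, e⟩ := hq.lift s
    obtain rfl := h.index_eq (s := (reprSheaf J).map t ≫ s') (s' := (reprSheaf J).map c ≫ a) (by
      rw [Category.assoc, es', reassoc_of% e, Category.assoc, ea])
    exact ⟨s', es'⟩)
  exact ⟨j, g, hg.symm⟩

end SheafCoproduct

namespace QuotientEnlargement

variable {C : Type u} [Category.{v} C] [EssentiallySmall.{v} C] {J : GrothendieckTopology C}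
  {E : QuotientEnlargement J}

/-! ### Comparison of `FC̃` with the category of sheaves -/

section Bridge

/-- Morphisms over an object of `FC̃` can be computed in the category of sheaves. -/
def homOverEquiv {F F' V : E.FC} (f : F ⟶ F') (a : V ⟶ F') :
    HomOver a f ≃ HomOver a.hom f.hom where
  toFun s := ⟨s.1.hom, congrArg (fun φ => φ.hom) s.2⟩
  invFun s := ⟨ObjectProperty.homMk s.1, by ext1; exact s.2⟩
  left_inv _ := rfl
  right_inv _ := rfl

lemma splits_fromC_iff {F F' V : E.FC} {f : F ⟶ F'} {a : V ⟶ F'} :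
    Splits E.fromC f a ↔ Splits (reprSheaf J) f.hom a.hom := by
  constructor
  · intro h
    refine ⟨have := h.finite; Finite.of_equiv _ (homOverEquiv f a), fun W b => ?_⟩
    let b' : E.fromC.obj W ⟶ V := ObjectProperty.homMk b
    exact ((homOverEquiv f (b' ≫ a)).bijective.comp (h.bijective b')).comp
      (homOverEquiv f a).symm.bijective
  · intro h
    refine ⟨have := h.finite; Finite.of_equiv _ (homOverEquiv f a).symm, fun W b => ?_⟩
    exact ((homOverEquiv f (b ≫ a)).symm.bijective.comp (h.bijective b.hom)).comp
      (homOverEquiv f a).bijective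

lemma isFiniteLocallyConstant_fromC_iff {F F' : E.FC} {f : F ⟶ F'} :
    IsFiniteLocallyConstant J E.fromC f ↔ IsFiniteLocallyConstant J (reprSheaf J) f.hom := by
  constructor
  · intro h X a
    exact J.superset_covering (fun W b hb => (splits_fromC_iff (f := f)
      (a := E.fromC.map b ≫ ObjectProperty.homMk a)).1 hb) (h X (ObjectProperty.homMk a))
  · intro h X a
    exact J.superset_covering (fun W b hb => splits_fromC_iff.2 hb) (h X a.hom)

lemma isSectionwiseCoproduct_fromC {ι : Type*} {N : ι → E.FC} {F : E.FC} {incl : ∀ i, N i ⟶ F}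
    (h : IsSectionwiseCoproduct (reprSheaf J) (fun i => (incl i).hom)) :
    IsSectionwiseCoproduct E.fromC incl := by
  intro X a
  obtain ⟨⟨i, s⟩, hs, hs'⟩ := h X a.hom
  refine ⟨⟨i, ObjectProperty.homMk s⟩, by ext1; exact hs, ?_⟩
  rintro ⟨i', s'⟩ rfl
  have e := hs' ⟨i', s'.hom⟩ rfl
  obtain rfl : i' = i := congrArg Sigma.fst e
  obtain rfl : s'.hom = s := eq_of_heq (Sigma.mk.inj e).2
  rfl

lemma fc_hom_ext {F F' : E.FC} {φ ψ : F ⟶ F'}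
    (h : ∀ (X : C) (a : E.fromC.obj X ⟶ F), a ≫ φ = a ≫ ψ) : φ = ψ := by
  ext1
  exact sheaf_hom_ext fun X a => congrArg (fun φ => φ.hom) (h X (ObjectProperty.homMk a))

end Bridge

/-! ### Components, `FT̃` and degrees -/

section Components

lemma Decomposition.isSectionwiseCoproduct (hJ : IsBSite J) {F : Sheaf J (Type v)}
    (d : E.Decomposition F) : IsSectionwiseCoproduct (reprSheaf J) d.incl :=
  isSectionwiseCoproduct_of_isColimit hJ d.isColimit

lemma exists_section_component (hJ : IsBSite J) (X : E.Tilde) :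
    ∃ Z : C, Nonempty ((reprSheaf J).obj Z ⟶ X.obj) := by
  obtain ⟨Z, H, q, -, -⟩ :=
    moderateQuotients.exists_isQuotientMap hJ (E.le_moderate _ X.property)
  exact ⟨Z, ⟨q⟩⟩

variable {F F' : E.FC} {f : F ⟶ F'}

lemma IsComponentAt.hom_eq {i : piZero F} {j : piZero F'} {g : component F i ⟶ component F' j}
    (h : IsComponentAt f i j g) :
    (decomposition F).incl i ≫ f.hom = g.hom ≫ (decomposition F').incl j :=
  congrArg (fun φ => φ.hom) h

/-- The component of `f` at `i` is well-defined, because the components are non-empty. -/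
lemma IsComponentAt.sigma_eq (hJ : IsBSite J) {i : piZero F} {j j' : piZero F'}
    {g : component F i ⟶ component F' j} {g' : component F i ⟶ component F' j'}
    (h : IsComponentAt f i j g) (h' : IsComponentAt f i j' g') :
    (⟨j, g⟩ : Σ j, (component F i ⟶ component F' j)) = ⟨j', g'⟩ := by
  obtain ⟨Z, ⟨q⟩⟩ := exists_section_component hJ (component F i)
  have hd := (decomposition F').isSectionwiseCoproduct hJ
  have e : g.hom ≫ (decomposition F').incl j = g'.hom ≫ (decomposition F').incl j' :=
    h.hom_eq.symm.trans h'.hom_eq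
  obtain rfl := hd.index_eq (s := q ≫ g.hom) (s' := q ≫ g'.hom) (by
    rw [Category.assoc, e, Category.assoc])
  have : g = g' := by
    ext1
    exact sheaf_hom_ext fun X a => hd.hom_eq (by rw [Category.assoc, e, Category.assoc])
  rw [this]

/-- For `f` in `FT̃`, sections of a component whose image is in the component `j` exist only if `f`
maps this component to `j`. -/
lemma FT.comp_incl_ne (hJ : IsBSite J) (hf : FT f) {j : piZero F'} (i : piZero F)
    (hi : i ∉ {i | ∃ g : component F i ⟶ component F' j, IsComponentAt f i j g})
    (X : C) (s : (reprSheaf J).obj X ⟶ (component F i).obj)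
    (a : (reprSheaf J).obj X ⟶ (component F' j).obj) :
    s ≫ (decomposition F).incl i ≫ f.hom ≠ a ≫ (decomposition F').incl j := by
  intro e
  obtain ⟨j', g, hg, -⟩ := hf i
  rw [hg.hom_eq, ← Category.assoc] at e
  obtain rfl := ((decomposition F').isSectionwiseCoproduct hJ).index_eq e
  exact hi ⟨g, hg⟩

lemma FT.tildeT_of_isComponentAt (hJ : IsBSite J) (hf : FT f) {i : piZero F} {j : piZero F'}
    {g : component F i ⟶ component F' j} (hg : IsComponentAt f i j g) : E.tildeT g := by
  obtain ⟨j', g', hg', ht⟩ := hf i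
  have e := hg.sigma_eq hJ hg'
  obtain rfl : j = j' := congrArg Sigma.fst e
  obtain rfl : g = g' := eq_of_heq (Sigma.mk.inj e).2
  exact ht

lemma FT.isFiniteLocallyConstant_hom (hJ : IsYSite J) (hfin : HasFiniteOverHoms J) (hf : FT f) :
    IsFiniteLocallyConstant J (reprSheaf J) f.hom := by
  have hB := hJ.isBSite
  have hd' := (decomposition F').isSectionwiseCoproduct hB
  intro X a
  obtain ⟨j, a, rfl⟩ := hd'.exists_eq a
  let K : Set (piZero F) := {i | ∃ g : component F i ⟶ component F' j, IsComponentAt f i j g}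
  choose g hg using fun i : K => i.2
  obtain ⟨R, hR, hR'⟩ := exists_covering_forall (fun i : K => splitSieve (g i).hom a)
    (fun i => tildeT.isFiniteLocallyConstant hJ hfin (hf.tildeT_of_isComponentAt hB (hg i)) X a)
  refine J.superset_covering (fun W b hb => ?_) hR
  have := splits_comp_incl (a := (reprSheaf J).map b ≫ a)
    ((decomposition F).isSectionwiseCoproduct hB) (fun _ _ _ => hd'.hom_eq) (fun i => (g i).hom)
    (fun i => (hg i).hom_eq) (hf.comp_incl_ne hB) (fun i => hR' i _ hb)
  rwa [Category.assoc] at this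

/-- The members of `FT̃` are the finite locally constant morphisms of `FC̃`. -/
lemma FT_iff (hJ : IsYSite J) (hfin : HasFiniteOverHoms J) :
    FT f ↔ IsFiniteLocallyConstant J E.fromC f := by
  rw [isFiniteLocallyConstant_fromC_iff]
  refine ⟨fun hf => hf.isFiniteLocallyConstant_hom hJ hfin, fun hf i => ?_⟩
  have hB := hJ.isBSite
  have hd' := (decomposition F').isSectionwiseCoproduct hB
  obtain ⟨j, g, hg⟩ := exists_factor_of_moderate hB (E.le_moderate _ (component F i).property) hd'
    ((decomposition F).incl i ≫ f.hom)
  refine ⟨j, ObjectProperty.homMk g, by ext1; exact hg, ?_⟩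
  refine tildeT_of_isFiniteLocallyConstant hB (E.le_moderate _ (component F i).property)
    (E.le_moderate _ (component F' j).property) fun X a => ?_
  refine J.superset_covering (fun W b hb => ?_) (hf X (a ≫ (decomposition F').incl j))
  have hb : Splits (reprSheaf J) f.hom ((reprSheaf J).map b ≫ a ≫ (decomposition F').incl j) := hb
  rw [← Category.assoc] at hb
  exact splits_of_splits_comp_incl ((decomposition F).isSectionwiseCoproduct hB)
    (fun _ _ _ => hd'.hom_eq) hg hb

/-- The degree at `j` is the cardinality of the fibres over the component `j`. -/
lemma degreeFC_eq_card (hJ : IsYSite J) (hfin : HasFiniteOverHoms J) (hf : FT f) {j : piZero F'}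
    {X : C} (a : (reprSheaf J).obj X ⟶ (component F' j).obj)
    (ha : Splits (reprSheaf J) f.hom (a ≫ (decomposition F').incl j)) :
    degreeFC f j = Nat.card (HomOver (a ≫ (decomposition F').incl j) f.hom) := by
  classical
  have hB := hJ.isBSite
  have hd := (decomposition F).isSectionwiseCoproduct hB
  have hd' := (decomposition F').isSectionwiseCoproduct hB
  let K : Set (piZero F) := {i | ∃ g : component F i ⟶ component F' j, IsComponentAt f i j g}
  have hg := fun i : K => i.2.choose_spec
  have hs : ∀ i : K, Splits (reprSheaf J) i.2.choose.hom a := fun i =>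
    splits_of_splits_comp_incl hd (fun _ _ _ => hd'.hom_eq) (hg i).hom_eq ha
  have hbij := bijective_sigma_homOver hd (fun _ _ _ => hd'.hom_eq) (fun i : K => i.2.choose.hom)
    (fun i => (hg i).hom_eq) (hf.comp_incl_ne hB) a
  have := fun i => (hs i).finite
  rw [← Nat.card_congr (Equiv.ofBijective _ hbij), Nat.card_sigma, degreeFC,
    ← Fintype.sum_subtype_add_sum_subtype (fun i => i ∈ K)]
  have h₁ : ∀ i : {i // i ∉ K}, (if h : ∃ g : component F i.1 ⟶ component F' j,
      IsComponentAt f i.1 j g then E.degree h.choose else 0) = 0 := fun i => dif_neg i.2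
  rw [Finset.sum_congr rfl (fun i _ => h₁ i), Finset.sum_const_zero, add_zero]
  refine Finset.sum_congr (by congr) fun i _ => ?_
  exact (dif_pos i.2).trans
    (degree_eq_card hJ hfin (hf.tildeT_of_isComponentAt hB (hg i)) (hs i))

end Components

/-! ### Finite coproducts in `FC̃` -/

section Coproducts

/-- The coproduct of sheaves of a finite family of objects of `FC̃` is in `FC̃`: its components are
those of the members of the family. -/
lemma exists_coproduct (hJ : IsBSite J) {I : Type} [Finite I] (N : I → E.FC) :
    ∃ c : Cofan N, Nonempty (IsColimit c) ∧ IsSectionwiseCoproduct E.fromC c.inj := by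
  have h := isSectionwiseCoproduct_sigmaSheafIncl hJ (fun i => (N i).obj)
  let K := Σ i : I, Fin (decomposition (N i)).n
  have hK := (h.sigma fun i => (decomposition (N i)).isSectionwiseCoproduct hJ).reindex
    (Finite.equivFin K).symm
  obtain ⟨hK⟩ := hK.nonempty_isColimit
  let P : E.FC := ⟨sigmaSheaf hJ (fun i => (N i).obj),
    ⟨{ n := Nat.card K
       comp := fun k => component (N ((Finite.equivFin K).symm k).1) ((Finite.equivFin K).symm k).2
       incl := _
       isColimit := hK }⟩⟩
  obtain ⟨hc⟩ := h.nonempty_isColimit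
  refine ⟨Cofan.mk P fun i => ObjectProperty.homMk (sigmaSheafIncl hJ (fun i => (N i).obj) i),
    ⟨Cofan.IsColimit.mk _
      (fun s => ObjectProperty.homMk (hc.desc (Cofan.mk s.pt.obj fun i => (s.inj i).hom)))
      (fun s i => ?_) (fun s m hm => ?_)⟩, isSectionwiseCoproduct_fromC h⟩
  · ext1
    exact hc.fac (Cofan.mk s.pt.obj fun i => (s.inj i).hom) ⟨i⟩
  · ext1
    exact hc.uniq (Cofan.mk s.pt.obj fun i => (s.inj i).hom) m.hom
      (fun ⟨i⟩ => congrArg (fun φ => φ.hom) (hm i))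

/-- Finite coproducts in `FC̃` are coproducts on sections. -/
lemma isSectionwiseCoproduct_of_isColimit_fc (hJ : IsBSite J) {I : Type} [Finite I]
    {N : I → E.FC} {c : Cofan N} (hc : IsColimit c) : IsSectionwiseCoproduct E.fromC c.inj := by
  obtain ⟨c', ⟨hc'⟩, h⟩ := exists_coproduct hJ N
  have := h.of_iso (hc'.coconePointUniqueUpToIso hc)
  have e : ∀ i, c'.inj i ≫ (hc'.coconePointUniqueUpToIso hc).hom = c.inj i :=
    fun i => hc'.comp_coconePointUniqueUpToIso_hom hc ⟨i⟩
  simpa only [e] using this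

/-- `FC̃` contains the empty sheaf. -/
lemma exists_empty (hJ : IsBSite J) (E : QuotientEnlargement J) :
    ∃ F₀ : E.FC, ∀ X : C, IsEmpty (E.fromC.obj X ⟶ F₀) := by
  obtain ⟨c, -, h⟩ := exists_coproduct hJ (E := E) (fun i : Empty => i.elim)
  refine ⟨c.pt, fun X => ⟨fun a => ?_⟩⟩
  obtain ⟨i, -⟩ := h.exists_eq a
  exact i.elim

lemma isEmpty_of_isInitial (hJ : IsBSite J) {F : E.FC} (hF : IsInitial F) (X : C) :
    IsEmpty (E.fromC.obj X ⟶ F) := by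
  obtain ⟨F₀, h⟩ := exists_empty hJ E
  exact ⟨fun a => (h X).elim (a ≫ hF.to F₀)⟩

variable {G : E.FCᵒᵖ ⥤ AddCommGrpCat.{w}}

/-- The empty sieve covers an initial object, which has no sections over the objects of `C`. -/
lemma subsingleton_of_isInitial (hJ : IsBSite J)
    (hG : Presieve.IsSheaf E.topology (G ⋙ forget AddCommGrpCat.{w})) {F : E.FC}
    (hF : IsInitial F) : Subsingleton (G.obj (op F)) :=
  ⟨fun _ _ => sheaf_ext hG fun X a => (isEmpty_of_isInitial hJ hF X).elim a⟩

/-- The inclusions of the components generate a covering sieve, and the compatibility of a family of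
elements is automatic because the components are disjoint. -/
lemma bijective_of_isColimit (hJ : IsBSite J)
    (hG : Presieve.IsSheaf E.topology (G ⋙ forget AddCommGrpCat.{w})) {I : Type} [Finite I]
    (N : I → E.FC) (c : Cofan N) (hc : IsColimit c) :
    Function.Bijective (fun (x : G.obj (op c.pt)) (i : I) => (G.map (c.inj i).op).hom x) := by
  have h := isSectionwiseCoproduct_of_isColimit_fc hJ hc
  have hcov : Sieve.generate (Presieve.ofArrows N c.inj) ∈ E.topology c.pt := by
    intro X a
    obtain ⟨i, s, rfl⟩ := h.exists_eq a
    refine J.superset_covering (fun W b _ => ?_) (J.top_mem X)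
    exact ⟨_, E.fromC.map b ≫ s, _, Presieve.ofArrows.mk i, by simp⟩
  have hs := (Presieve.isSheafFor_iff_generate _).2 (hG _ hcov)
  rw [Presieve.isSheafFor_arrows_iff] at hs
  rw [Function.bijective_iff_existsUnique]
  intro x
  obtain ⟨y, hy, hy'⟩ := hs x (by
    intro i i' Z g g' e
    refine eq_of_locally_eq hG fun X a => ⟨⊤, J.top_mem X, fun W b _ => ?_⟩
    simp only [← types_comp_apply, ← Functor.map_comp, ← op_comp]
    have e' : ((E.fromC.map b ≫ a) ≫ g) ≫ c.inj i = ((E.fromC.map b ≫ a) ≫ g') ≫ c.inj i' := by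
      simp only [Category.assoc, e]
    generalize (E.fromC.map b ≫ a) ≫ g = s at e'
    generalize (E.fromC.map b ≫ a) ≫ g' = s' at e'
    obtain rfl := h.index_eq e'
    rw [h.hom_eq e'])
  exact ⟨y, funext hy, fun y' h => hy' y' (congrFun h)⟩

end Coproducts

/-! ### Cartesian squares in `FC̃` -/

section Squares

/-- Morphisms of `FC̃` can be defined by their action on sections. -/
lemma exists_fc_hom {F F' : E.FC}
    (φ : ∀ X : C, (E.fromC.obj X ⟶ F) → (E.fromC.obj X ⟶ F'))
    (hφ : ∀ (X Y : C) (b : Y ⟶ X) (a : E.fromC.obj X ⟶ F),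
      φ Y (E.fromC.map b ≫ a) = E.fromC.map b ≫ φ X a) :
    ∃ f : F ⟶ F', ∀ (X : C) (a : E.fromC.obj X ⟶ F), a ≫ f = φ X a := by
  obtain ⟨f, hf⟩ := exists_sheaf_hom (F := F.obj) (F' := F'.obj)
    (fun X a => (φ X (ObjectProperty.homMk a)).hom)
    (fun X Y b a => congrArg (fun ψ => ψ.hom) (hφ X Y b (ObjectProperty.homMk a)))
  exact ⟨ObjectProperty.homMk f, fun X a => by ext1; exact hf X a.hom⟩

/-- If `a` splits `f`, the pullback of `f` along `a` is a disjoint sum of copies of the base, one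
for each lift of `a`. -/
lemma isPullback_of_splits {F F' : E.FC} {f : F ⟶ F'} {X : C} {a : E.fromC.obj X ⟶ F'}
    (ha : Splits E.fromC f a) {ι : Type} (ε : ι ≃ HomOver a f)
    {c : Cofan (fun _ : ι => E.fromC.obj X)} (hc : IsColimit c)
    (hs : IsSectionwiseCoproduct E.fromC c.inj) {g : c.pt ⟶ F} {p : c.pt ⟶ E.fromC.obj X}
    (hg : ∀ i, c.inj i ≫ g = (ε i).1) (hp : ∀ i, c.inj i ≫ p = 𝟙 _) : IsPullback g p f a := by
  have w : g ≫ f = p ≫ a := Cofan.IsColimit.hom_ext hc _ _ fun i => by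
    rw [reassoc_of% hg, (ε i).2, reassoc_of% hp]
  have hlift : ∀ s : PullbackCone f a, ∃ l : s.pt ⟶ c.pt, l ≫ g = s.fst ∧ l ≫ p = s.snd := by
    intro s
    have key : ∀ (W : C) (z : E.fromC.obj W ⟶ s.pt), ∃! i : ι,
        (z ≫ s.snd) ≫ (ε i).1 = z ≫ s.fst := by
      intro W z
      have h := (ha.bijective (z ≫ s.snd)).comp ε.bijective
      obtain ⟨i, hi, hi'⟩ := Function.bijective_iff_existsUnique _ |>.1 h
        ⟨z ≫ s.fst, by simp only [Category.assoc, s.condition]⟩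
      exact ⟨i, congrArg Subtype.val hi, fun i' h' => hi' i' (Subtype.ext h')⟩
    choose i hi hi' using key
    obtain ⟨l, hl⟩ := exists_fc_hom (F := s.pt) (F' := c.pt)
      (fun W z => (z ≫ s.snd) ≫ c.inj (i W z)) (fun W W' b z => by
        rw [← hi' W' (E.fromC.map b ≫ z) (i W z) (by simp only [Category.assoc] at hi ⊢; rw [hi])]
        simp only [Category.assoc])
    refine ⟨l, fc_hom_ext fun W z => ?_, fc_hom_ext fun W z => ?_⟩
    · rw [← Category.assoc, hl, Category.assoc, hg, hi]
    · rw [← Category.assoc, hl, Category.assoc, hp, Category.comp_id]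
  choose l hl hl' using hlift
  refine ⟨⟨w⟩, ⟨PullbackCone.IsLimit.mk w l hl hl' fun s m hm hm' => ?_⟩⟩
  refine fc_hom_ext fun W z => ?_
  obtain ⟨i, r, er⟩ := hs.exists_eq (z ≫ m)
  obtain ⟨i', r', er'⟩ := hs.exists_eq (z ≫ l s)
  have e₁ : r = z ≫ s.snd := by
    rw [← hm', ← Category.assoc, ← er, Category.assoc, hp, Category.comp_id]
  have e₂ : r' = z ≫ s.snd := by
    rw [← hl', ← Category.assoc, ← er', Category.assoc, hp, Category.comp_id]
  subst e₁
  subst e₂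
  rw [← er, ← er']
  have e : ε i = ε i' := ((ha.bijective (z ≫ s.snd))).1 (Subtype.ext (by
    change (z ≫ s.snd) ≫ (ε i).1 = (z ≫ s.snd) ≫ (ε i').1
    rw [← hg, ← hg, ← Category.assoc, er, ← Category.assoc, er', Category.assoc, Category.assoc,
      hm, hl]))
  rw [ε.injective e]

variable {ι : Type} {N : ι → E.FC} {F : E.FC} {incl : ∀ i, N i ⟶ F}

lemma mono_incl (h : IsSectionwiseCoproduct E.fromC incl) (i : ι) : Mono (incl i) :=
  ⟨fun u v e => fc_hom_ext fun X a => h.hom_eq (by simp only [Category.assoc, e])⟩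

/-- Distinct components are disjoint. -/
lemma isPullback_disjoint (h : IsSectionwiseCoproduct E.fromC incl) {i j : ι} (hij : i ≠ j)
    {F₀ : E.FC} (hF₀ : ∀ X : C, IsEmpty (E.fromC.obj X ⟶ F₀)) :
    ∃ (u : F₀ ⟶ N i) (v : F₀ ⟶ N j), IsPullback u v (incl i) (incl j) := by
  have hto : ∀ Z : E.FC, (∀ X : C, IsEmpty (E.fromC.obj X ⟶ Z)) → ∀ Z', ∃ _ : Z ⟶ Z', True := by
    intro Z hZ Z'
    obtain ⟨f, -⟩ := exists_fc_hom (F := Z) (F' := Z') (fun X a => ((hZ X).false a).elim)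
      (fun X _ _ a => ((hZ X).false a).elim)
    exact ⟨f, trivial⟩
  have hext : ∀ Z : E.FC, (∀ X : C, IsEmpty (E.fromC.obj X ⟶ Z)) →
      ∀ (Z' : E.FC) (φ ψ : Z ⟶ Z'), φ = ψ :=
    fun Z hZ Z' φ ψ => fc_hom_ext fun X a => ((hZ X).false a).elim
  obtain ⟨u, -⟩ := hto F₀ hF₀ (N i)
  obtain ⟨v, -⟩ := hto F₀ hF₀ (N j)
  have hcone : ∀ (s : PullbackCone (incl i) (incl j)) (X : C), IsEmpty (E.fromC.obj X ⟶ s.pt) :=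
    fun s X => ⟨fun a => hij (h.index_eq (s := a ≫ s.fst) (s' := a ≫ s.snd) (by
      rw [Category.assoc, s.condition, Category.assoc]))⟩
  choose l _ using fun s => hto _ (hcone s) F₀
  exact ⟨u, v, ⟨hext _ hF₀ _ _ _⟩, ⟨PullbackCone.IsLimit.mk _ l (fun s => hext _ (hcone s) _ _ _)
    (fun s => hext _ (hcone s) _ _ _) (fun s m _ _ => hext _ (hcone s) _ _ _)⟩⟩

/-- The inclusion of a component has one lift over this component, and none over the others. -/
lemma isFiniteLocallyConstant_incl (h : IsSectionwiseCoproduct E.fromC incl) (i : ι) :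
    IsFiniteLocallyConstant J E.fromC (incl i) := by
  intro X a
  refine J.superset_covering (fun W b _ => ?_) (J.top_mem X)
  change Splits _ _ (E.fromC.map b ≫ a)
  generalize E.fromC.map b ≫ a = a
  obtain ⟨j, s, rfl⟩ := h.exists_eq a
  have hsub : ∀ (V : C) (a : E.fromC.obj V ⟶ F), Subsingleton (HomOver a (incl i)) :=
    fun V a => ⟨fun r r' => Subtype.ext (h.hom_eq (r.2.trans r'.2.symm))⟩
  refine ⟨have := hsub W; inferInstance, fun V b' => ⟨fun r r' _ => (hsub _ _).elim r r', ?_⟩⟩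
  rintro ⟨r, hr⟩
  rw [← Category.assoc] at hr
  obtain rfl := h.index_eq hr
  exact ⟨⟨s, rfl⟩, (hsub _ _).elim _ _⟩

end Squares

/-! ### Existence and uniqueness of transfers -/

section Uniqueness

variable {G : E.FCᵒᵖ ⥤ AddCommGrpCat.{w}}

/-- `f_* ∘ f^*` is the multiplication by the degree, for the transfers given by traces. -/
lemma trace_map (hJ : IsYSite J) (hfin : HasFiniteOverHoms J)
    (hG : Presieve.IsSheaf E.topology (G ⋙ forget AddCommGrpCat.{w}))
    {F F' : E.FC} {f : F ⟶ F'} (hf : FT f) (j : piZero F') (x : G.obj (op F')) :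
    (G.map (componentIncl F' j).op).hom
        ((trace hG ((FT_iff hJ hfin).1 hf)).hom ((G.map f.op).hom x)) =
      degreeFC f j • (G.map (componentIncl F' j).op).hom x := by
  have hflc := (FT_iff hJ hfin).1 hf
  refine sheaf_ext hG fun X a => ⟨_, hflc X (a ≫ componentIncl F' j), fun W b hb => ?_⟩
  have hb : Splits E.fromC f (E.fromC.map b ≫ a ≫ componentIncl F' j) := hb
  rw [← Category.assoc] at hb
  generalize E.fromC.map b ≫ a = c at hb
  have key := map_trace_map hG hflc hb x
  rw [Nat.card_congr (homOverEquiv f (c ≫ componentIncl F' j)), op_comp, G.map_comp] at key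
  rw [map_nsmul, degreeFC_eq_card hJ hfin hf c.hom (splits_fromC_iff.1 hb)]
  exact key

namespace TransferStructure

variable (t : TransferStructure G)

include t in
lemma ext_coproduct {I : Type} [Finite I] {N : I → E.FC} {c : Cofan N} (hc : IsColimit c)
    {x y : G.obj (op c.pt)} (h : ∀ i, (G.map (c.inj i).op).hom x = (G.map (c.inj i).op).hom y) :
    x = y :=
  (t.coproduct I N c hc).1 (funext h)

/-- The transfer along an identity is the identity, as the degree of an identity is `1`. -/
lemma push_id (hJ : IsYSite J) (hfin : HasFiniteOverHoms J)
    (hG : Presieve.IsSheaf E.topology (G ⋙ forget AddCommGrpCat.{w})) {F : E.FC} {f : F ⟶ F}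
    (hf : FT f) (e : f = 𝟙 F) (x : G.obj (op F)) : (t.push f hf).hom x = x := by
  subst e
  have h₁ : ∀ y, (t.push (𝟙 F) hf).hom y =
      (trace hG ((FT_iff hJ hfin).1 hf)).hom y := by
    intro y
    refine sheaf_ext hG fun X a => ⟨⊤, J.top_mem X, fun W b _ => ?_⟩
    generalize E.fromC.map b ≫ a = c
    obtain ⟨j, s, es⟩ := ((decomposition F).isSectionwiseCoproduct hJ.isBSite).exists_eq c.hom
    obtain rfl : (ObjectProperty.homMk s :
        E.fromC.obj W ⟶ E.toFC.obj (component F j)) ≫ componentIncl F j = c := by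
      ext1
      exact es
    have e₁ := t.push_pull (𝟙 F) hf j y
    have e₂ := trace_map hJ hfin hG hf j y
    rw [op_id, G.map_id] at e₁ e₂
    have e := e₁.trans e₂.symm
    rw [op_comp, G.map_comp, AddCommGrpCat.hom_comp, AddMonoidHom.comp_apply,
      AddMonoidHom.comp_apply]
    exact congrArg _ e
  rw [h₁]
  refine eq_of_splits hG ((FT_iff hJ hfin).1 hf) fun X a ha => ?_
  have hr : ∀ r : HomOver a (𝟙 F), r.1 = a := fun r => by simpa using r.2
  have : Unique (HomOver a (𝟙 F)) :=
    ⟨⟨⟨a, Category.comp_id a⟩⟩, fun r => Subtype.ext (hr r)⟩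
  rw [map_trace hG _ ha, traceSum, finsum_unique, hr]

/-- For a coproduct of copies of one object, the transfer along the codiagonal is the sum of the
components. Indeed an element of a coproduct is the sum of the transfers of its components, by the
base change formula for the inclusions of the components. -/
lemma push_codiagonal (hJ : IsYSite J) (hfin : HasFiniteOverHoms J)
    (hG : Presieve.IsSheaf E.topology (G ⋙ forget AddCommGrpCat.{w})) {X : E.FC} {I : Type}
    [Fintype I] {c : Cofan (fun _ : I => X)} (hc : IsColimit c) {p : c.pt ⟶ X}
    (hp : ∀ i, c.inj i ≫ p = 𝟙 _) (hp' : FT p) (y : G.obj (op c.pt)) :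
    (t.push p hp').hom y = ∑ i, (G.map (c.inj i).op).hom y := by
  classical
  have hB := hJ.isBSite
  have hs := isSectionwiseCoproduct_of_isColimit_fc hB hc
  have hi : ∀ i, FT (c.inj i) := fun i =>
    (FT_iff hJ hfin).2 (isFiniteLocallyConstant_incl hs i)
  have hself : ∀ i z, (G.map (c.inj i).op).hom ((t.push (c.inj i) (hi i)).hom z) = z := by
    intro i z
    have := mono_incl hs i
    obtain ⟨hid, e⟩ := t.base_change _ _ _ _ (IsKernelPair.id_of_mono (c.inj i)) (hi i)
    have e := congrArg (fun φ => φ.hom z) e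
    simp only [AddCommGrpCat.hom_comp, AddMonoidHom.comp_apply] at e
    rw [e, t.push_id hJ hfin hG hid rfl, op_id, G.map_id]
    rfl
  have hother : ∀ i k z, i ≠ k →
      (G.map (c.inj k).op).hom ((t.push (c.inj i) (hi i)).hom z) = 0 := by
    intro i k z hik
    obtain ⟨F₀, hF₀⟩ := exists_empty hB E
    obtain ⟨u, v, sq⟩ := isPullback_disjoint hs hik hF₀
    obtain ⟨hv, e⟩ := t.base_change _ _ _ _ sq (hi i)
    have e := congrArg (fun φ => φ.hom z) e
    simp only [AddCommGrpCat.hom_comp, AddMonoidHom.comp_apply] at e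
    have hzero : (G.map u.op).hom z = 0 := sheaf_ext hG fun X a => ((hF₀ X).false a).elim
    rw [e, hzero, map_zero]
  have hy : y = ∑ i, (t.push (c.inj i) (hi i)).hom ((G.map (c.inj i).op).hom y) := by
    refine t.ext_coproduct hc fun k => ?_
    rw [map_sum, Finset.sum_eq_single k (fun i _ hik => hother i k _ hik)
      (fun h => absurd (Finset.mem_univ k) h), hself]
  conv_lhs => rw [hy]
  rw [map_sum]
  refine Finset.sum_congr rfl fun i _ => ?_
  obtain ⟨h, e⟩ := t.push_comp (c.inj i) p (hi i) hp'
  rw [← AddMonoidHom.comp_apply, ← AddCommGrpCat.hom_comp, ← e, t.push_id hJ hfin hG h (hp i)]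

/-- The transfers are determined: after base change along a splitting morphism, `f` becomes a
codiagonal. -/
lemma push_eq_trace (hJ : IsYSite J) (hfin : HasFiniteOverHoms J)
    (hG : Presieve.IsSheaf E.topology (G ⋙ forget AddCommGrpCat.{w})) {F F' : E.FC} {f : F ⟶ F'}
    (hf : FT f) : t.push f hf = trace hG ((FT_iff hJ hfin).1 hf) := by
  refine eq_trace hG _ _ fun X a ha x => ?_
  have := ha.finite
  let ε := (Finite.equivFin (HomOver a f)).symm
  obtain ⟨c, ⟨hc⟩, hs⟩ := exists_coproduct hJ.isBSite
    (fun _ : Fin (Nat.card (HomOver a f)) => E.fromC.obj X)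
  let g : c.pt ⟶ F := Cofan.IsColimit.desc hc (fun i => (ε i).1)
  let p : c.pt ⟶ E.fromC.obj X := Cofan.IsColimit.desc hc (fun _ => 𝟙 _)
  have hg : ∀ i, c.inj i ≫ g = (ε i).1 := Cofan.IsColimit.fac hc _
  have hp : ∀ i, c.inj i ≫ p = 𝟙 _ := Cofan.IsColimit.fac hc _
  obtain ⟨hp', e⟩ := t.base_change _ _ _ _ (isPullback_of_splits ha ε hc hs hg hp) hf
  have e := congrArg (fun φ => φ.hom x) e
  simp only [AddCommGrpCat.hom_comp, AddMonoidHom.comp_apply] at e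
  rw [e, t.push_codiagonal hJ hfin hG hc hp, traceSum, ← finsum_eq_sum_of_fintype]
  refine finsum_eq_of_bijective ε ε.bijective fun i => ?_
  rw [← AddMonoidHom.comp_apply, ← AddCommGrpCat.hom_comp, ← G.map_comp, ← op_comp, hg]

lemma eq_of_push_eq {t t' : TransferStructure G}
    (h : ∀ ⦃F F' : E.FC⦄ (f : F ⟶ F') (hf : FT f), t.push f hf = t'.push f hf) : t = t' := by
  have e : t.push = t'.push := by
    funext F F' f hf
    exact h f hf
  cases t
  cases t'
  congr

end TransferStructure

/-- The transfers of a sheaf of abelian groups. -/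
noncomputable def transferStructure (hJ : IsYSite J) (hfin : HasFiniteOverHoms J)
    (hG : Presieve.IsSheaf E.topology (G ⋙ forget AddCommGrpCat.{w})) : TransferStructure G where
  initial _ hF := subsingleton_of_isInitial hJ.isBSite hG hF
  coproduct _ _ N c hc := bijective_of_isColimit hJ.isBSite hG N c hc
  push _ _ _ hf := trace hG ((FT_iff hJ hfin).1 hf)
  push_comp _ _ _ _ _ hf' hf :=
    ⟨(FT_iff hJ hfin).2 (((FT_iff hJ hfin).1 hf').comp ((FT_iff hJ hfin).1 hf)),
      trace_comp hG _ _⟩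
  base_change _ _ _ _ _ _ _ _ sq hf' :=
    ⟨(FT_iff hJ hfin).2 (((FT_iff hJ hfin).1 hf').of_isPullback sq), trace_base_change hG sq _⟩
  push_pull _ _ _ hf j x := trace_map hJ hfin hG hf j x

end Uniqueness

/-! ### Rings -/

section Rings

variable {G : E.FCᵒᵖ ⥤ RingCat.{w}}

variable (hG : Presieve.IsSheaf E.topology (underlyingAb G ⋙ forget AddCommGrpCat.{w}))

/-- The trace, as a map between rings. -/
noncomputable def ringTrace {F F' : E.FC} {f : F ⟶ F'} (hf : IsFiniteLocallyConstant J E.fromC f) :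
    G.obj (op F) →+ G.obj (op F') :=
  (trace hG hf).hom

lemma map_ringTrace {F F' : E.FC} {f : F ⟶ F'} (hf : IsFiniteLocallyConstant J E.fromC f) {X : C}
    {a : E.fromC.obj X ⟶ F'} (ha : Splits E.fromC f a) (x : G.obj (op F)) :
    (G.map a.op).hom (ringTrace hG hf x) = ∑ᶠ s : HomOver a f, (G.map s.1.op).hom x :=
  map_trace hG hf ha x

include hG in
lemma ring_eq_of_splits {F F' : E.FC} {f : F ⟶ F'} (hf : IsFiniteLocallyConstant J E.fromC f)
    {y y' : G.obj (op F')} (h : ∀ (X : C) (a : E.fromC.obj X ⟶ F'), Splits E.fromC f a →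
      (G.map a.op).hom y = (G.map a.op).hom y') : y = y' :=
  eq_of_splits hG hf h

lemma map_lift_map {F F' V : E.FC} {f : F ⟶ F'} {a : V ⟶ F'} (s : HomOver a f)
    (y : G.obj (op F')) : (G.map s.1.op).hom ((G.map f.op).hom y) = (G.map a.op).hom y := by
  rw [← RingHom.comp_apply, ← RingCat.hom_comp, ← G.map_comp, ← op_comp, s.2]

/-- The projection formula holds because the pullbacks are ring homomorphisms. -/
lemma ringTrace_mul_map {F F' : E.FC} {f : F ⟶ F'} (hf : IsFiniteLocallyConstant J E.fromC f)
    (x : G.obj (op F)) (y : G.obj (op F')) :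
    ringTrace hG hf (x * (G.map f.op).hom y) = ringTrace hG hf x * y := by
  refine ring_eq_of_splits hG hf fun X a ha => ?_
  have := ha.finite
  rw [map_ringTrace hG hf ha, map_mul, map_ringTrace hG hf ha, finsum_mul' _ _ (Set.toFinite _)]
  exact finsum_congr fun s => by rw [map_mul, map_lift_map]

lemma ringTrace_map_mul {F F' : E.FC} {f : F ⟶ F'} (hf : IsFiniteLocallyConstant J E.fromC f)
    (x : G.obj (op F)) (y : G.obj (op F')) :
    ringTrace hG hf ((G.map f.op).hom y * x) = y * ringTrace hG hf x := by
  refine ring_eq_of_splits hG hf fun X a ha => ?_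
  have := ha.finite
  rw [map_ringTrace hG hf ha, map_mul, map_ringTrace hG hf ha, mul_finsum' _ _ (Set.toFinite _)]
  exact finsum_congr fun s => by rw [map_mul, map_lift_map]

end Rings

end QuotientEnlargement

end YSite

theorem mainTheorem6 {C : Type u} [Category.{v} C] [EssentiallySmall.{v} C]
    (J : GrothendieckTopology C) (hJ : YSite.IsYSite J) (hfin : YSite.HasFiniteOverHoms J)
    (E : YSite.QuotientEnlargement J) :
    (∀ G : E.FCᵒᵖ ⥤ AddCommGrpCat.{w},
      Presieve.IsSheaf E.topology (G ⋙ forget AddCommGrpCat.{w}) →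
        ∃ t : YSite.QuotientEnlargement.TransferStructure G, ∀ t', t' = t) ∧
    (∀ G : E.FCᵒᵖ ⥤ RingCat.{w},
      Presieve.IsSheaf E.topology (G ⋙ forget RingCat.{w}) →
        ∃ t : YSite.QuotientEnlargement.RingTransferStructure G, ∀ t', t' = t) := by
  have unique : ∀ {G : E.FCᵒᵖ ⥤ AddCommGrpCat.{w}},
      Presieve.IsSheaf E.topology (G ⋙ forget AddCommGrpCat.{w}) →
        ∀ t t' : YSite.QuotientEnlargement.TransferStructure G, t' = t := fun hG t t' =>
    YSite.QuotientEnlargement.TransferStructure.eq_of_push_eq fun F F' f hf => by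
      rw [t'.push_eq_trace hJ hfin hG hf, t.push_eq_trace hJ hfin hG hf]
  refine ⟨fun G hG => ⟨YSite.QuotientEnlargement.transferStructure hJ hfin hG, unique hG _⟩,
    fun G hG => ?_⟩
  have hG' : Presieve.IsSheaf E.topology
      (YSite.QuotientEnlargement.underlyingAb G ⋙ forget AddCommGrpCat.{w}) := hG
  refine ⟨{ YSite.QuotientEnlargement.transferStructure hJ hfin hG' with
    projection_right := fun _ _ _ hf x y =>
      YSite.QuotientEnlargement.ringTrace_mul_map hG' ((YSite.QuotientEnlargement.FT_iff hJ hfin).1 hf) x y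
    projection_left := fun _ _ _ hf x y =>
      YSite.QuotientEnlargement.ringTrace_map_mul hG' ((YSite.QuotientEnlargement.FT_iff hJ hfin).1 hf) x y },
    fun t' => ?_⟩
  have e := unique hG' (YSite.QuotientEnlargement.transferStructure hJ hfin hG')
    t'.toTransferStructure
  cases t'
  congr
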